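/- Work over a field of characteristic zero; vector spaces are $\mathbb Z_2$-graded, $\tilde a$ is the parity of $a$, and $\Pi$ is parity reversion. An $L_\infty$-algebra is a vector space with odd, graded symmetric multilinear brackets of all arities $n\ge 0$ whose Jacobiators $$J^n(a_1,\dots,a_n)=\sum_{k+l=n}\ \sum_{(k,l)\text{-shuffles }\sigma}\pm\{\{a_{\sigma(1)},\dots,a_{\sigma(k)}\},a_{\sigma(k+1)},\dots,a_{\sigma(n)}\}$$ (with the Koszul sign) all vanish. An $L_\infty$-morphism $\varphi$ is a family of even graded symmetric multilinear maps $\varphi_n$, $n\ge1$, with $$\sum_{S\subset\{1,\dots,n\}}\pm\varphi(\{a_S\},a_{S^c})=\sum_{B_1\sqcup\dots\sqcup B_r=\{1,\dots,n\}}\pm\{\varphi(a_{B_1}),\dots,\varphi(a_{B_r})\}$$ for all $n\ge 0$, the right-hand sum being over partitions into nonempty blocks; composition is $(\psi\varphi)_n(a)=\sum_{B_1\sqcup\dots\sqcup B_r}\pm\psi_r(\varphi(a_{B_1}),\dots,\varphi(a_{B_r}))$. An $L_\infty$-morphism is strict if $\varphi_n=0$ for $n\neq1$. A cocylinder diagram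 for an $L_\infty$-morphism $f:X\to Y$ is a factorization $f=p\circ j$, $X\xrightarrow{j}Z\xrightarrow{p}Y$, through an $L_\infty$-algebra $Z$ by $L_\infty$-morphisms such that the linear part of $j$ is injective (cofibration) and a quasi-isomorphism of the underlying complexes (weak equivalence), and the linear part of $p$ is surjective (fibration). The fiber of $p$ is its kernel in the category of $L_\infty$-algebras; it is called a homotopy fiber (cocone) of $f$. Let $L$ be a Lie superalgebra, $L=K\oplus V$ with $K$ a subalgebra and $V$ an Abelian subalgebra (both graded subspaces), $P:L\to V$ the projector with kernel $K$, and $D$ an odd derivation of $L$ with $D^2=0$ and $D(K)\subset K$. Regard $\Pi L$ as an $L_\infty$-algebra with $\{\Pi x\}=-\Pi Dx$, $\{\Pi x,\Pi y\}=(-1)^{\tilde x}\Pi[x,y]$ and all other brackets zero, and similarly $\Pi K$; let $i:\Pi K\to\Pi L$ be the inclusion. On $\Pi L\oplus V$ take the brackets: the unary bracket $d(\Pi x,a)=(-\Pi Dx,\,P(x+Da))$; the binary bracket $\{\Pi x,\Pi y\}=(-1)^{\tilde x}\Pi[x,y]$; and $$\{\Pi x,a_1,\dots,a_n\}=P[\dots[x,a_1],\dots,a_n]\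 (n\ge1),\qquad \{a_1,\dots,a_n\}=P[\dots[Da_1,a_2],\dots,a_n]\ (n\ge2),$$ for $x,y\in L$, $a_k\in V$, together with those obtained by symmetry; all other brackets, including the $0$-ary one, are zero. Then: 1. $\Pi L\oplus V$ is an $L_\infty$-algebra, and, with the strict morphisms $j(\Pi x)=(\Pi x,0)$ and $p(\Pi x,a)=\Pi x$, it is a cocylinder for $i:\Pi K\to\Pi L$ in the category of $L_\infty$-algebras. 2. $V$ with the higher derived brackets $\{a_1,\dots,a_n\}_D=P[\dots[Da_1,a_2],\dots,a_n]$, $n\ge1$ (and zero $0$-ary bracket) is an $L_\infty$-algebra; with the strict morphism $a\mapsto(0,a)$ it is the fiber of $p$ in the category of $L_\infty$-algebras. Hence it is a homotopy fiber (cocone), in this category, of the inclusion $i$ of differential Lie superalgebras. -/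

import Mathlib

universe u v

namespace DerivedBrackets

/-! ## Spaces with brackets, `L∞`-algebras -/

/-- A vector space with a family of two subspaces `gr 0` (even part) and `gr 1` (odd part), and one
operation for each arity, written as a function on finite lists:
`bracket [a₁, …, aₙ]` is `{a₁, …, aₙ}`. This is bare data: the laws are in `IsLInfinityAlgebra`. -/
structure BracketSpace (𝕜 : Type u) [Field 𝕜] where
  carrier : Type v
  [addCommGroup : AddCommGroup carrier]
  [module : Module 𝕜 carrier]
  gr : ZMod 2 → Submodule 𝕜 carrier
  bracket : List carrier → carrier

attribute [instance] BracketSpace.addCommGroup BracketSpace.module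

section General

variable {𝕜 : Type u} [Field 𝕜]

/-- A family of operations `X × ⋯ × X → Y`, one for each arity, is multilinear. -/
structure IsMultilinearFamily {X Y : Type*} [AddCommGroup X] [Module 𝕜 X] [AddCommGroup Y]
    [Module 𝕜 Y] (f : List X → Y) : Prop where
  map_add : ∀ (l r : List X) (x y : X), f (l ++ (x + y) :: r) = f (l ++ x :: r) + f (l ++ y :: r)
  map_smul : ∀ (l r : List X) (c : 𝕜) (x : X), f (l ++ (c • x) :: r) = c • f (l ++ x :: r)

/-- Symmetry in the `ℤ/2`-graded sense (for transpositions of neighbours, which generate). -/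
def IsGradedSymmetric {X Y : Type*} [AddCommGroup X] [Module 𝕜 X] [AddCommGroup Y]
    (gr : ZMod 2 → Submodule 𝕜 X) (f : List X → Y) : Prop :=
  ∀ (l r : List X) (p q : ZMod 2) (x y : X), x ∈ gr p → y ∈ gr q →
    f (l ++ x :: y :: r) = ((-1 : ℤˣ) ^ (p * q)) • f (l ++ y :: x :: r)

/-- All operations of the family have parity `e`. -/
def HasParity {X Y : Type*} [AddCommGroup X] [Module 𝕜 X] [AddCommGroup Y] [Module 𝕜 Y]
    (grX : ZMod 2 → Submodule 𝕜 X) (grY : ZMod 2 → Submodule 𝕜 Y) (e : ZMod 2)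
    (f : List X → Y) : Prop :=
  ∀ (l : List X) (p : List (ZMod 2)), List.Forall₂ (fun x i => x ∈ grX i) l p →
    f l ∈ grY (e + p.sum)

/-- Given a labelling `c` of the positions `0, …, n - 1`, the arguments with label `s`, in their
original order. -/
def select {X κ : Type*} [DecidableEq κ] {n : ℕ} (c : Fin n → κ) (s : κ) (a : Fin n → X) :
    List X :=
  ((List.finRange n).filter (fun i => c i = s)).map a

/-- The sign of the permutation that brings arguments of parities `p` into the order of increasing
labels `c`, keeping the order of arguments with the same label: each pair of odd arguments that
changes places contributes `-1`. -/
def koszulSign {n r : ℕ} (p : Fin n → ZMod 2) (c : Fin n → Fin r) : ℤˣ :=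
  ∏ i : Fin n, ∏ j : Fin n, if i < j ∧ c j < c i then (-1 : ℤˣ) ^ (p i * p j) else 1

/-- The `n`-th Jacobiator. A labelling `c` of the `n` positions by `0` and `1` is the same as a
`(k, l)`-shuffle with `k + l = n`: the arguments labelled `0` go, in order, to the inner bracket,
and those labelled `1` to the outer one. -/
def BracketSpace.jacobiator (A : BracketSpace.{u, v} 𝕜) {n : ℕ} (p : Fin n → ZMod 2)
    (a : Fin n → A.carrier) : A.carrier :=
  ∑ c : Fin n → Fin 2,
    koszulSign p c • A.bracket (A.bracket (select c 0 a) :: select c 1 a)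

/-- An `L∞`-algebra: a `ℤ/2`-graded vector space with odd symmetric multilinear operations of all
arities `0, 1, 2, …` such that all Jacobiators vanish. -/
structure BracketSpace.IsLInfinityAlgebra (A : BracketSpace.{u, v} 𝕜) : Prop where
  isCompl : IsCompl (A.gr 0) (A.gr 1)
  multilinear : IsMultilinearFamily (𝕜 := 𝕜) A.bracket
  symmetric : IsGradedSymmetric A.gr A.bracket
  odd : HasParity A.gr A.gr 1 A.bracket
  jacobi : ∀ (n : ℕ) (p : Fin n → ZMod 2) (a : Fin n → A.carrier), (∀ i, a i ∈ A.gr (p i)) →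
    A.jacobiator p a = 0

/-! ## The category of `L∞`-algebras -/

/-- A labelling `c` of `0, …, n - 1` by `0, …, r - 1` that stands for a partition into `r` nonempty
blocks, the blocks being numbered in the order of their least elements. -/
def IsPartition {n r : ℕ} (c : Fin n → Fin r) : Prop :=
  Function.Surjective c ∧
    ∀ s t : Fin r, s < t → ∃ i, c i = s ∧ ∀ j, c j = t → i < j

open scoped Classical in
/-- The Taylor coefficients of a composite `ψ ∘ φ`:
`∑ ± ψ (φ (a_{B₁}), …, φ (a_{Bᵣ}))` over all partitions `B₁, …, Bᵣ` of the arguments `a`,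
which are of parities `p`. -/
noncomputable def substitute {X Y Z : Type*} [AddCommGroup Z] (ψ : List Y → Z) (φ : List X → Y)
    {n : ℕ} (p : Fin n → ZMod 2) (a : Fin n → X) : Z :=
  ∑ r ∈ Finset.range (n + 1), ∑ c : Fin n → Fin r,
    if IsPartition c then
      koszulSign p c • ψ (List.ofFn fun s : Fin r => φ (select c s a))
    else 0

/-- An `L∞`-morphism `A → B`, given by its Taylor coefficients: even symmetric multilinear maps
`φₙ : A × ⋯ × A → B`, `n ≥ 1`, intertwining the brackets,
`∑ ± φ ({a_S}, a_{Sᶜ}) = ∑ ± {φ (a_{B₁}), …, φ (a_{Bᵣ})}`. -/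
structure IsLInfinityMorphism (A B : BracketSpace.{u, v} 𝕜) (φ : List A.carrier → B.carrier) :
    Prop where
  zero : φ [] = 0
  multilinear : IsMultilinearFamily (𝕜 := 𝕜) φ
  symmetric : IsGradedSymmetric A.gr φ
  even : HasParity A.gr B.gr 0 φ
  intertwines : ∀ (n : ℕ) (p : Fin n → ZMod 2) (a : Fin n → A.carrier), (∀ i, a i ∈ A.gr (p i)) →
    ∑ c : Fin n → Fin 2, koszulSign p c • φ (A.bracket (select c 0 a) :: select c 1 a) =
      substitute B.bracket φ p a

/-- `χ = ψ ∘ φ` for `L∞`-morphisms `φ : A → B`, `ψ : B → C`, `χ : A → C`. -/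
def IsComposite {A B C : BracketSpace.{u, v} 𝕜} (ψ : List B.carrier → C.carrier)
    (φ : List A.carrier → B.carrier) (χ : List A.carrier → C.carrier) : Prop :=
  ∀ (n : ℕ) (p : Fin n → ZMod 2) (a : Fin n → A.carrier), (∀ i, a i ∈ A.gr (p i)) →
    substitute ψ φ p a = χ (List.ofFn a)

/-- The Taylor coefficients of a linear map: all coefficients but the first one vanish. -/
def strict {X Y : Type*} [AddCommGroup X] [Module 𝕜 X] [AddCommGroup Y] [Module 𝕜 Y]
    (f : X →ₗ[𝕜] Y) : List X → Y
  | [x] => f x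
  | _ => 0

/-- The underlying complexes make sense (the `0`-ary brackets vanish), and the linear part of `φ`
induces an isomorphism of their homology `ker / im`. -/
structure IsQuasiIso (A B : BracketSpace.{u, v} 𝕜) (φ : List A.carrier → B.carrier) : Prop where
  source_flat : A.bracket [] = 0
  target_flat : B.bracket [] = 0
  injective_homology : ∀ x : A.carrier, A.bracket [x] = 0 → (∃ z, φ [x] = B.bracket [z]) →
    ∃ y, x = A.bracket [y]
  surjective_homology : ∀ z : B.carrier, B.bracket [z] = 0 →
    ∃ x : A.carrier, A.bracket [x] = 0 ∧ ∃ w, z = φ [x] + B.bracket [w]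

/-- The diagram `X --j--> Z --p--> Y` is a cocylinder diagram for `f : X → Y` in the category of
`L∞`-algebras: `f = p ∘ j`, where `j` is a monomorphism on the underlying complexes (cofibration)
and a quasi-isomorphism (weak equivalence), and `p` is an epimorphism on the underlying complexes
(fibration). -/
structure IsCocylinder (X Z Y : BracketSpace.{u, v} 𝕜) (f : List X.carrier → Y.carrier)
    (j : List X.carrier → Z.carrier) (p : List Z.carrier → Y.carrier) : Prop where
  source : X.IsLInfinityAlgebra
  cocyl : Z.IsLInfinityAlgebra
  target : Y.IsLInfinityAlgebra
  morphism_f : IsLInfinityMorphism X Y f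
  morphism_j : IsLInfinityMorphism X Z j
  morphism_p : IsLInfinityMorphism Z Y p
  comp : IsComposite (A := X) (B := Z) (C := Y) p j f
  cofibration : Function.Injective fun x : X.carrier => j [x]
  weakEquivalence : IsQuasiIso X Z j
  fibration : Function.Surjective fun z : Z.carrier => p [z]

/-- `ι : F → Z` is the fiber (kernel) of `p : Z → Y` in the category of `L∞`-algebras. -/
structure IsFiber (F Z Y : BracketSpace.{u, v} 𝕜) (ι : List F.carrier → Z.carrier)
    (p : List Z.carrier → Y.carrier) : Prop where
  fiber : F.IsLInfinityAlgebra
  morphism_ι : IsLInfinityMorphism F Z ι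
  comp : IsComposite (A := F) (B := Z) (C := Y) p ι (fun _ => 0)
  universal : ∀ (W : BracketSpace.{u, v} 𝕜) (φ : List W.carrier → Z.carrier),
    W.IsLInfinityAlgebra → IsLInfinityMorphism W Z φ →
    IsComposite (A := W) (B := Z) (C := Y) p φ (fun _ => 0) →
    ∃! ψ : List W.carrier → F.carrier,
      IsLInfinityMorphism W F ψ ∧ IsComposite (A := W) (B := F) (C := Z) ι ψ φ

/-- `F` is a homotopy fiber (cocone) of `f : X → Y` in the category of `L∞`-algebras: the fiber of
`p` for some cocylinder diagram `X → Z → Y` of `f`. -/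
def IsHomotopyFiber (F X Y : BracketSpace.{u, v} 𝕜) (f : List X.carrier → Y.carrier) : Prop :=
  ∃ (Z : BracketSpace.{u, v} 𝕜) (j : List X.carrier → Z.carrier) (p : List Z.carrier → Y.carrier)
    (ι : List F.carrier → Z.carrier), IsCocylinder X Z Y f j p ∧ IsFiber F Z Y ι p

end General

/-! ## Differential Lie superalgebras -/

/-- A differential Lie superalgebra: a Lie superalgebra with an odd derivation of square zero. -/
structure DiffLieSuperalgebra (𝕜 : Type u) [Field 𝕜] (L : Type v) [AddCommGroup L]
    [Module 𝕜 L] where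
  gr : ZMod 2 → Submodule 𝕜 L
  isCompl : IsCompl (gr 0) (gr 1)
  br : L →ₗ[𝕜] L →ₗ[𝕜] L
  br_mem : ∀ (p q : ZMod 2) (x y : L), x ∈ gr p → y ∈ gr q → br x y ∈ gr (p + q)
  br_antisymm : ∀ (p q : ZMod 2) (x y : L), x ∈ gr p → y ∈ gr q →
    br x y = -(((-1 : ℤˣ) ^ (p * q)) • br y x)
  jacobi : ∀ (p q : ZMod 2) (x y z : L), x ∈ gr p → y ∈ gr q →
    br x (br y z) = br (br x y) z + ((-1 : ℤˣ) ^ (p * q)) • br y (br x z)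
  D : L →ₗ[𝕜] L
  D_odd : ∀ (p : ZMod 2) (x : L), x ∈ gr p → D x ∈ gr (p + 1)
  D_leibniz : ∀ (p : ZMod 2) (x y : L), x ∈ gr p →
    D (br x y) = br (D x) y + ((-1 : ℤˣ) ^ p) • br x (D y)
  D_sq : ∀ x : L, D (D x) = 0

namespace DiffLieSuperalgebra

variable {𝕜 : Type u} [Field 𝕜] {L : Type v} [AddCommGroup L] [Module 𝕜 L]

/-- A subspace in the `ℤ/2`-graded sense: it contains the even and odd parts of its elements. -/
def IsGradedSubspace (A : DiffLieSuperalgebra 𝕜 L) (S : Submodule 𝕜 L) : Prop :=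
  ∀ x ∈ S, ∃ y ∈ S ⊓ A.gr 0, ∃ z ∈ S ⊓ A.gr 1, x = y + z

/-- A differential Lie subalgebra `K`, as a differential Lie superalgebra. -/
def restrict (A : DiffLieSuperalgebra 𝕜 L) (K : Submodule 𝕜 L) (hK : A.IsGradedSubspace K)
    (hbr : ∀ x ∈ K, ∀ y ∈ K, A.br x y ∈ K) (hD : ∀ x ∈ K, A.D x ∈ K) :
    DiffLieSuperalgebra 𝕜 K where
  gr p := (A.gr p).comap K.subtype
  isCompl := by
    constructor
    · rw [Submodule.disjoint_def]
      intro x h0 h1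
      exact Subtype.ext (Submodule.disjoint_def.1 A.isCompl.disjoint x.1 h0 h1)
    · rw [codisjoint_iff, eq_top_iff]
      rintro ⟨x, hx⟩ -
      obtain ⟨y, hy, z, hz, h⟩ := hK x hx
      exact Submodule.mem_sup.2 ⟨⟨y, hy.1⟩, hy.2, ⟨z, hz.1⟩, hz.2, Subtype.ext h.symm⟩
  br := LinearMap.mk₂ 𝕜 (fun x y => (⟨A.br x y, hbr x x.2 y y.2⟩ : K))
    (fun x y z => Subtype.ext (by simp)) (fun c x y => Subtype.ext (by simp))
    (fun x y z => Subtype.ext (by simp)) (fun c x y => Subtype.ext (by simp))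
  br_mem p q x y hx hy := A.br_mem p q x y hx hy
  br_antisymm p q x y hx hy := Subtype.ext (by
    simpa [Units.smul_def] using A.br_antisymm p q x y hx hy)
  jacobi p q x y z hx hy := Subtype.ext (by
    simpa [Units.smul_def] using A.jacobi p q x y z hx hy)
  D := A.D.restrict hD
  D_odd p x hx := A.D_odd p x hx
  D_leibniz p x y hx := Subtype.ext (by
    simpa [Units.smul_def] using A.D_leibniz p x y hx)
  D_sq x := Subtype.ext (A.D_sq x)

variable (A : DiffLieSuperalgebra 𝕜 L)

/-- The even part of an element. -/
noncomputable def evenPart : L →ₗ[𝕜] L := Submodule.projection (A.gr 0) (A.gr 1) A.isCompl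

/-- The odd part of an element. -/
noncomputable def oddPart : L →ₗ[𝕜] L := Submodule.projection (A.gr 1) (A.gr 0) A.isCompl.symm

/-- The parity operator `x ↦ (-1)^x̃ x`. -/
noncomputable def parity : L →ₗ[𝕜] L := A.evenPart - A.oddPart

/-- The parity shift `ΠL` of a differential Lie superalgebra, with its usual `L∞`-structure:
`{Πx} = -ΠDx`, `{Πx, Πy} = (-1)^x̃ Π[x, y]`, and all other brackets zero.
The element `x` of the carrier stands for `Πx`. -/
noncomputable def shift : BracketSpace.{u, v} 𝕜 where
  carrier := L
  gr p := A.gr (p + 1)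
  bracket
    | [x] => -A.D x
    | [x, y] => A.br (A.parity x) y
    | _ => 0

/-- `[…[[x, a₁], a₂], …, aₙ]`. -/
def nested (x : L) (a : List L) : L := a.foldl (fun y b => A.br y b) x

variable {K V : Submodule 𝕜 L} (h : IsCompl K V)

/-- The higher derived brackets of `D` on `V`,
`{a₁, …, aₖ} = P[…[[Da₁, a₂], a₃], …, aₖ]` for `k ≥ 1`, and zero for `k = 0`, where `P` is the
projector onto `V` parallel to `K`. -/
noncomputable def derivedBracket : List V → V
  | [] => 0
  | a :: as => Submodule.projectionOnto V K h.symm (A.nested (A.D a) (as.map (↑)))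

/-- `V` with the higher derived brackets of `D`. -/
noncomputable def derivedSpace : BracketSpace.{u, v} 𝕜 where
  carrier := V
  gr p := (A.gr p).comap V.subtype
  bracket := A.derivedBracket h

/-- The bracket `{(Πx₁, a₁), …, (Πxₙ, aₙ)}` in `ΠL ⊕ V`.
The component in `ΠL` is `-ΠDx₁` for `n = 1`, `(-1)^x̃₁ Π[x₁, x₂]` for `n = 2`, and zero otherwise.
The component in `V` is the derived bracket `{a₁, …, aₙ}` plus the sum over `i` of the brackets with
all arguments in `V` but the `i`-th one, obtained from
`{Πx, b₁, …, bₘ} = P[…[x, b₁], …, bₘ]` (for `m = 0` this is the term `Px` of the differential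
`d (Πx, a) = (-ΠDx, P (x + Da))`) by symmetry: when `Πxᵢ` moves to the front, nothing changes if
`xᵢ` is odd, that is, if `Πxᵢ` is even; if `xᵢ` is even, each argument that `Πxᵢ` passes contributes
the sign given by its parity. -/
noncomputable def cocylBracket (z : List (L × V)) : L × V :=
  (A.shift.bracket (z.map Prod.fst),
    A.derivedBracket h (z.map Prod.snd) +
      ∑ i : Fin z.length, Submodule.projectionOnto V K h.symm
        (let x : L := (z.get i).1
         let pre : List L := (z.take i).map fun w => (w.2 : L)
         let post : List L := (z.drop (i + 1)).map fun w => (w.2 : L)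
         A.nested (A.oddPart x) (pre ++ post) +
           A.nested (A.evenPart x) (pre.map A.parity ++ post)))

/-- The space `ΠL ⊕ V` with its brackets. The pair `(x, a)` stands for `(Πx, a)`. -/
noncomputable def cocylSpace : BracketSpace.{u, v} 𝕜 where
  carrier := L × V
  gr p := (A.gr (p + 1)).prod ((A.gr p).comap V.subtype)
  bracket := A.cocylBracket h

end DiffLieSuperalgebra

end DerivedBrackets

/-! Everything rests on one property of the projector: since `K` and `V` are subalgebras, `V` is
Abelian and `D` preserves `K`, one has P[x, y] = P[Px, y] + P[x, Py] (`projection_br`) and PDx =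
PDPx (`projection_D`). Bracketing on the right with a₁, …, aₙ ∈ V acts on [x, y] by the graded
Leibniz rule (`nested_br`), so it gives a sum of ±[x_S, y_T] over all unshuffles, where x_S is the
iterated bracket of x with the arguments in S. Apply P, expand by the property above, and use that
Px_S lies in V and therefore commutes, up to sign, past the remaining bracketings by elements of V.
The result is `projected_nested_identity`, which is the V-component of the Jacobiator of Πx, Πy, a₁,
…, aₙ.

The Jacobiators with fewer arguments from ΠL are the same identity in a larger algebra. Adjoin an
odd element Δ with [Δ, y] = Dy and [Δ, Δ] = 0 (`adjoinDerivation`), and put PΔ = 0; a derived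
bracket is then P of the iterated bracket starting at Δ. The choice x = Δ gives the Jacobiator with
one argument from ΠL. The choice x = y = Δ gives twice the Jacobiator of the derived brackets on V,
and one divides by 2. With three or more arguments from ΠL every V-component vanishes. The
Jacobiator is multilinear and graded symmetric, so it suffices to treat lists with the ΠL-arguments
first (`cocyl_jacobi_of_pure`). Its ΠL-component is a Jacobiator of ΠL, which vanishes by D² = 0,
the Leibniz rule and the Jacobi identity.

For the cocylinder, a cycle (Πy, a) is homologous to (Π(y + Da), 0), and the cycle condition P(y +
Da) = 0 says that y + Da ∈ K; a similar correction proves injectivity on homology. For the fiber, an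
L∞-morphism killed by the strict projection p takes values in V, so it factors uniquely through the
inclusion (`isFiber_strict`). -/

namespace DerivedBrackets

/-! ### Signs with exponents in `ZMod 2`, so that comparing two signs is a finite check. -/

section Signs

variable {M : Type*} [AddCommGroup M]

theorem sign_smul_smul (p q : ZMod 2) (x : M) :
    ((-1 : ℤˣ) ^ p) • ((-1 : ℤˣ) ^ q) • x = ((-1 : ℤˣ) ^ (p + q)) • x := by
  rw [smul_smul, ← uzpow_add]

theorem neg_sign_smul (p : ZMod 2) (x : M) :
    -(((-1 : ℤˣ) ^ p) • x) = ((-1 : ℤˣ) ^ (p + 1)) • x := by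
  rw [uzpow_add, uzpow_one, mul_neg_one, Units.smul_def, Units.smul_def, Units.val_neg, neg_smul]

theorem map_intUnits_smul {N F : Type*} [AddCommGroup N] [FunLike F M N] [AddMonoidHomClass F M N]
    (f : F) (u : ℤˣ) (x : M) : f (u • x) = u • f x := by
  rw [Units.smul_def, Units.smul_def, map_zsmul]

end Signs

/-! ### Sums over unshuffles, by recursion on the list of arguments. -/

section Unshuffle

variable {α : Type*} {Y : Type*} [AddCommGroup Y] (par : α → ZMod 2)

/-- The total parity of a list. -/
def totalParity (l : List α) : ZMod 2 := (l.map par).sum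

@[simp] theorem totalParity_nil : totalParity par [] = 0 := rfl

@[simp] theorem totalParity_cons (x : α) (l : List α) :
    totalParity par (x :: l) = par x + totalParity par l := by simp [totalParity]

@[simp] theorem totalParity_append (l m : List α) :
    totalParity par (l ++ m) = totalParity par l + totalParity par m := by simp [totalParity]

/-- The sum of `± F s t` over all ways to split a list into two complementary sublists `s`, `t`,
with the Koszul sign of the unshuffle. -/
def unshuffleSum (F : List α → List α → Y) : List α → Y
  | [] => F [] []
  | x :: l => unshuffleSum (fun s t => F (x :: s) t) l +
      unshuffleSum (fun s t => ((-1 : ℤˣ) ^ (par x * totalParity par s)) • F s (x :: t)) l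

theorem unshuffleSum_add (F G : List α → List α → Y) (l : List α) :
    unshuffleSum par (fun s t => F s t + G s t) l =
      unshuffleSum par F l + unshuffleSum par G l := by
  induction l generalizing F G with
  | nil => rfl
  | cons x l ih => simp only [unshuffleSum, smul_add, ih]; abel

theorem map_unshuffleSum {Z E : Type*} [AddCommGroup Z] [FunLike E Y Z] [AddMonoidHomClass E Y Z]
    (f : E) (F : List α → List α → Y) (l : List α) :
    f (unshuffleSum par F l) = unshuffleSum par (fun s t => f (F s t)) l := by
  induction l generalizing F with
  | nil => rfl
  | cons x l ih => simp only [unshuffleSum, map_add, ih, map_intUnits_smul]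

theorem unshuffleSum_smul (u : ℤˣ) (F : List α → List α → Y) (l : List α) :
    unshuffleSum par (fun s t => u • F s t) l = u • unshuffleSum par F l :=
  (map_unshuffleSum par (DistribSMul.toAddMonoidHom Y u) F l).symm

theorem unshuffleSum_eq_zero {F : List α → List α → Y} (h : ∀ s t, F s t = 0) (l : List α) :
    unshuffleSum par F l = 0 := by
  induction l generalizing F with
  | nil => exact h _ _
  | cons x l ih =>
    simp only [unshuffleSum]
    rw [ih fun s t => h _ _, ih fun s t => by rw [h, smul_zero], add_zero]

@[simp] theorem unshuffleSum_zero (l : List α) :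
    unshuffleSum par (fun _ _ => (0 : Y)) l = 0 :=
  unshuffleSum_eq_zero par (fun _ _ => rfl) l

theorem unshuffleSum_eq_zero_of_length {F : List α → List α → Y} {l : List α}
    (h : ∀ s t, s.length + t.length = l.length → F s t = 0) : unshuffleSum par F l = 0 := by
  induction l generalizing F with
  | nil => exact h _ _ rfl
  | cons x l ih =>
    simp only [unshuffleSum]
    rw [ih fun s t e => h _ _ (by simp [← e]; omega),
      ih fun s t e => by rw [h _ _ (by simp [← e]; omega), smul_zero], add_zero]

theorem unshuffleSum_nil_left {F : List α → List α → Y} (h : ∀ x s t, F (x :: s) t = 0)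
    (l : List α) : unshuffleSum par F l = F [] l := by
  induction l generalizing F with
  | nil => rfl
  | cons x l ih =>
    simp only [unshuffleSum]
    rw [unshuffleSum_eq_zero par fun s t => h _ _ _, ih fun y s t => by rw [h, smul_zero]]
    simp

theorem unshuffleSum_nil_right {F : List α → List α → Y} (h : ∀ x s t, F s (x :: t) = 0)
    (l : List α) : unshuffleSum par F l = F l [] := by
  induction l generalizing F with
  | nil => rfl
  | cons x l ih =>
    simp only [unshuffleSum]
    rw [ih fun y s t => h _ _ _, unshuffleSum_eq_zero par fun s t => by rw [h, smul_zero], add_zero]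

theorem unshuffleSum_map {β : Type*} (g : β → α) (F : List α → List α → Y) (l : List β) :
    unshuffleSum par F (l.map g) =
      unshuffleSum (par ∘ g) (fun s t => F (s.map g) (t.map g)) l := by
  induction l generalizing F with
  | nil => rfl
  | cons x l ih =>
    simp only [List.map_cons, unshuffleSum, ih, totalParity, List.map_map, Function.comp_apply]

/-- Exchanging the two blocks permutes the unshuffles; the signs differ by that of moving one whole
block past the other. -/
theorem unshuffleSum_comm (F : List α → List α → Y) (l : List α) :
    unshuffleSum par F l =
      unshuffleSum par
        (fun s t => ((-1 : ℤˣ) ^ (totalParity par s * totalParity par t)) • F t s) l := by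
  induction l generalizing F with
  | nil => simp [unshuffleSum]
  | cons x l ih =>
    have key : ∀ a b c : ZMod 2, a * b + c * b = (c + a) * b ∧ a * b = c * a + a * (c + b) := by
      decide
    simp only [unshuffleSum]
    rw [ih fun s t => F (x :: s) t, ih fun s t => _ • F s (x :: t), add_comm]
    simp only [sign_smul_smul, totalParity_cons]
    congr 1
    · congr 1; funext s t
      rw [(key _ _ _).1]
    · congr 1; funext s t
      rw [← (key _ _ _).2]

/-- If two neighbours fall into the same block, the symmetry of `F` gives the sign; the two kinds of
splittings that separate them are exchanged, and their unshuffle signs differ by the same factor. -/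
theorem unshuffleSum_symm {F : List α → List α → Y}
    (h₁ : ∀ l r x y t, F (l ++ x :: y :: r) t =
      ((-1 : ℤˣ) ^ (par x * par y)) • F (l ++ y :: x :: r) t)
    (h₂ : ∀ s l r x y, F s (l ++ x :: y :: r) =
      ((-1 : ℤˣ) ^ (par x * par y)) • F s (l ++ y :: x :: r)) (l r : List α) (x y : α) :
    unshuffleSum par F (l ++ x :: y :: r) =
      ((-1 : ℤˣ) ^ (par x * par y)) • unshuffleSum par F (l ++ y :: x :: r) := by
  induction l generalizing F with
  | nil =>
    have key : ∀ a b c : ZMod 2, b * c = a * b + b * (a + c) ∧ a * (b + c) = a * b + a * c ∧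
      b * c + (a * c + a * b) = a * b + (a * c + b * c) := by decide
    have e₁ : ∀ s t, F (x :: y :: s) t = ((-1 : ℤˣ) ^ (par x * par y)) • F (y :: x :: s) t :=
      fun s t => h₁ [] s x y t
    have e₂ : ∀ s t, F s (x :: y :: t) = ((-1 : ℤˣ) ^ (par x * par y)) • F s (y :: x :: t) :=
      fun s t => h₂ s [] t x y
    simp only [List.nil_append, unshuffleSum, smul_add, ← unshuffleSum_smul, sign_smul_smul,
      totalParity_cons, e₁, e₂]
    simp only [(key (par x) (par y) _).1.symm, (key (par x) (par y) _).2.1,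
      (key (par x) (par y) _).2.2]
    abel
  | cons z l ih =>
    simp only [List.cons_append, unshuffleSum, smul_add]
    congr 1
    · exact ih (fun l' r x y t => h₁ (z :: l') r x y t) fun s l r x y => h₂ (z :: s) l r x y
    · refine ih (fun l' r x y t => ?_) fun s l' r x y => ?_
      · rw [h₁, smul_comm]
        simp only [totalParity_append, totalParity_cons, add_left_comm]
      · rw [show z :: (l' ++ x :: y :: r) = (z :: l') ++ x :: y :: r from rfl, h₂, smul_comm]
        rfl

/-- A relation between values at two lists that differ in one place carries over from `F` to its
sum over unshuffles. -/
theorem unshuffleSum_additive {x y z : α} (hx : par y = par x) (hz : par z = par x)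
    {F : List α → List α → Y}
    (h₁ : ∀ l r t, F (l ++ x :: r) t = F (l ++ y :: r) t + F (l ++ z :: r) t)
    (h₂ : ∀ s l r, F s (l ++ x :: r) = F s (l ++ y :: r) + F s (l ++ z :: r)) (l r : List α) :
    unshuffleSum par F (l ++ x :: r) =
      unshuffleSum par F (l ++ y :: r) + unshuffleSum par F (l ++ z :: r) := by
  induction l generalizing F with
  | nil =>
    simp only [List.nil_append, unshuffleSum, hx, hz]
    rw [add_add_add_comm, ← unshuffleSum_add par (fun s t => F (y :: s) t),
      ← unshuffleSum_add par (fun s t => _ • F s (y :: t))]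
    congr 2 <;> funext s t
    · exact h₁ [] s t
    · rw [← smul_add]; exact congrArg _ (h₂ s [] t)
  | cons w l ih =>
    simp only [List.cons_append, unshuffleSum]
    rw [ih (fun l' r t => h₁ (w :: l') r t) fun s l r => h₂ (w :: s) l r,
      ih (fun l' r t => ?_) fun s l' r => ?_]
    · abel
    · rw [h₁, smul_add]; simp only [totalParity_append, totalParity_cons, hx, hz]
    · rw [← smul_add]; exact congrArg _ (h₂ s (w :: l') r)

theorem select_cons {X κ : Type*} [DecidableEq κ] {n : ℕ} (c₀ : κ) (c : Fin n → κ) (s : κ)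
    (a : Fin (n + 1) → X) :
    select (Fin.cons c₀ c : Fin (n + 1) → κ) s a =
      if c₀ = s then a 0 :: select c s (a ∘ Fin.succ) else select c s (a ∘ Fin.succ) := by
  simp only [select, List.finRange_succ, List.filter_cons, Fin.cons_zero, List.filter_map]
  split_ifs <;> simp_all [Function.comp_def]

theorem map_select {X X' κ : Type*} [DecidableEq κ] {n : ℕ} (c : Fin n → κ) (s : κ)
    (a : Fin n → X) (g : X → X') : (select c s a).map g = select c s (g ∘ a) := by
  simp [select]

theorem koszulSign_cons {n r : ℕ} (p : Fin (n + 1) → ZMod 2) (c₀ : Fin r) (c : Fin n → Fin r) :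
    koszulSign p (Fin.cons c₀ c : Fin (n + 1) → Fin r) =
      (∏ j, if c j < c₀ then (-1 : ℤˣ) ^ (p 0 * p j.succ) else 1) *
        koszulSign (p ∘ Fin.succ) c := by
  simp [koszulSign, Fin.prod_univ_succ]

/-- An argument of parity `q` put in front with label 1 has to pass exactly the arguments labelled
0; this is the sign in the recursion of `unshuffleSum`. -/
theorem prod_sign_eq {n : ℕ} (q : ZMod 2) (p : Fin n → ZMod 2) (c : Fin n → Fin 2) :
    (∏ j, if c j < 1 then (-1 : ℤˣ) ^ (q * p j) else 1) =
      (-1 : ℤˣ) ^ (q * (select c 0 p).sum) := by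
  induction n with
  | zero => simp [select]
  | succ n ih =>
    obtain ⟨c₀, c, rfl⟩ : ∃ c₀ c', c = Fin.cons c₀ c' := ⟨c 0, Fin.tail c, by simp⟩
    rw [Fin.prod_univ_succ, select_cons]
    simp only [Fin.cons_zero, Fin.cons_succ]
    have := ih (p ∘ Fin.succ) c
    simp only [Function.comp_apply] at this
    rw [this]
    rcases Fin.exists_fin_two.1 ⟨c₀, rfl⟩ with h | h <;> subst h <;> simp [mul_add, uzpow_add]

/-- The sum over labellings is the recursively defined sum over unshuffles. -/
theorem sum_koszulSign_smul {n : ℕ} (a : Fin n → α) (F : List α → List α → Y) :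
    ∑ c : Fin n → Fin 2, koszulSign (par ∘ a) c • F (select c 0 a) (select c 1 a) =
      unshuffleSum par F (List.ofFn a) := by
  induction n generalizing F with
  | zero => simp [koszulSign, select, unshuffleSum]
  | succ n ih =>
    -- Split by the label of the first argument: label 0 adds no inversion, label 1 adds those
    -- counted by `prod_sign_eq`.
    rw [← (Fin.consEquiv fun _ => Fin 2).sum_comp, Fintype.sum_prod_type, Fin.sum_univ_two,
      List.ofFn_succ]
    have e : ∀ (i : Fin 2) (c : Fin n → Fin 2),
        (Fin.consEquiv fun _ => Fin 2) (i, c) = (Fin.cons i c : Fin (n + 1) → Fin 2) :=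
      fun _ _ => rfl
    simp only [unshuffleSum, e, koszulSign_cons, select_cons]
    rw [← ih fun i => a i.succ, ← ih fun i => a i.succ]
    congr 1
    · refine Finset.sum_congr rfl fun c _ => ?_
      simp only [Fin.not_lt_zero, Finset.prod_const_one, one_mul, if_true, Fin.zero_eq_one_iff, OfNat.ofNat_ne_one, if_false]
      rfl
    · refine Finset.sum_congr rfl fun c _ => ?_
      have := prod_sign_eq (par (a 0)) (par ∘ a ∘ Fin.succ) c
      simp only [Function.comp_apply] at this ⊢
      rw [this, mul_comm, mul_smul]
      simp [Function.comp_assoc, totalParity, map_select]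
      rfl

end Unshuffle

end DerivedBrackets

namespace DerivedBrackets

/-! ### Multilinear families. -/

section Multilinear

variable {𝕜 : Type u} [Field 𝕜] {X Y : Type*} [AddCommGroup X] [Module 𝕜 X] [AddCommGroup Y]
  [Module 𝕜 Y]

/-- A multilinear family as a linear map in one of its arguments. -/
def IsMultilinearFamily.toLinearMap {f : List X → Y} (hf : IsMultilinearFamily (𝕜 := 𝕜) f)
    (l r : List X) : X →ₗ[𝕜] Y where
  toFun x := f (l ++ x :: r)
  map_add' := hf.map_add l r
  map_smul' := hf.map_smul l r

theorem IsMultilinearFamily.map_intUnits_smul {f : List X → Y}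
    (hf : IsMultilinearFamily (𝕜 := 𝕜) f) (l r : List X) (u : ℤˣ) (x : X) :
    f (l ++ (u • x) :: r) = u • f (l ++ x :: r) :=
  DerivedBrackets.map_intUnits_smul (hf.toLinearMap l r) u x

theorem IsMultilinearFamily.map_zero {f : List X → Y} (hf : IsMultilinearFamily (𝕜 := 𝕜) f)
    {l : List X} (hl : (0 : X) ∈ l) : f l = 0 := by
  obtain ⟨s, t, rfl⟩ := List.append_of_mem hl
  exact (hf.toLinearMap s t).map_zero

theorem IsMultilinearFamily.comp_linearMap {Z : Type*} [AddCommGroup Z] [Module 𝕜 Z]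
    {f : List X → Y} (hf : IsMultilinearFamily (𝕜 := 𝕜) f) (g : Y →ₗ[𝕜] Z) :
    IsMultilinearFamily (𝕜 := 𝕜) fun l => g (f l) where
  map_add l r x y := by rw [hf.map_add, _root_.map_add]
  map_smul l r c x := by rw [hf.map_smul, _root_.map_smul]

theorem isMultilinearFamily_zero :
    IsMultilinearFamily (𝕜 := 𝕜) (fun _ => 0 : List X → Y) where
  map_add _ _ _ _ := (add_zero _).symm
  map_smul _ _ _ _ := (smul_zero _).symm

/-- Multilinear families that agree on homogeneous arguments are equal. -/
theorem IsMultilinearFamily.ext_homogeneous {f g : List X → Y}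
    (hf : IsMultilinearFamily (𝕜 := 𝕜) f) (hg : IsMultilinearFamily (𝕜 := 𝕜) g)
    {gr : ZMod 2 → Submodule 𝕜 X} (hgr : IsCompl (gr 0) (gr 1))
    (h : ∀ (n : ℕ) (p : Fin n → ZMod 2) (a : Fin n → X), (∀ i, a i ∈ gr (p i)) →
      f (List.ofFn a) = g (List.ofFn a)) : f = g := by
  have h' : ∀ l : List (Σ p, gr p), f (l.map fun z => z.2.1) = g (l.map fun z => z.2.1) := by
    intro l
    have := h l.length (fun i => (l.get i).1) (fun i => (l.get i).2.1) fun i => (l.get i).2.2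
    rwa [show (List.ofFn fun i => ((l.get i).2 : X)) = l.map fun z => z.2.1 from by
      conv_rhs => rw [← List.ofFn_get l, List.map_ofFn]
      rfl] at this
  -- The prefix `s` holds the arguments that are already homogeneous; each induction step splits the
  -- next one into its even and odd parts.
  suffices ∀ (l : List X) (s : List (Σ p, gr p)),
      f (s.map (fun z => z.2.1) ++ l) = g (s.map (fun z => z.2.1) ++ l) from
    funext fun l => this l []
  intro l
  induction l with
  | nil => simpa using h'
  | cons x l ih =>
    intro s
    obtain ⟨y, hy, z, hz, rfl⟩ := Submodule.mem_sup.1 (hgr.sup_eq_top ▸ Submodule.mem_top (x := x))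
    rw [hf.map_add, hg.map_add]
    have e₁ := ih (s ++ [⟨0, y, hy⟩])
    have e₂ := ih (s ++ [⟨1, z, hz⟩])
    simp only [List.map_append, List.map_cons, List.map_nil, List.append_assoc,
      List.singleton_append] at e₁ e₂
    rw [e₁, e₂]

end Multilinear

/-! ### Composition with strict families. -/

section Strict

variable {𝕜 : Type u} [Field 𝕜] {X Y Z : Type*} [AddCommGroup X] [Module 𝕜 X] [AddCommGroup Y]
  [Module 𝕜 Y] [AddCommGroup Z] [Module 𝕜 Z]

theorem strict_eq_zero (f : X →ₗ[𝕜] Y) {l : List X} (hl : l.length ≠ 1) : strict f l = 0 := by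
  match l with
  | [] => rfl
  | [x] => simp at hl
  | _ :: _ :: _ => rfl

@[simp] theorem strict_singleton (f : X →ₗ[𝕜] Y) (x : X) : strict f [x] = f x := rfl

theorem strict_map (g : Y →ₗ[𝕜] Z) (f : X →ₗ[𝕜] Y) (l : List X) :
    strict g (l.map f) = strict (g.comp f) l := by
  match l with
  | [] => rfl
  | [x] => rfl
  | _ :: _ :: _ => rfl

theorem strict_isMultilinearFamily (f : X →ₗ[𝕜] Y) :
    IsMultilinearFamily (𝕜 := 𝕜) (strict f) where
  map_add l r x y := by
    match l, r with
    | [], [] => exact f.map_add x y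
    | [], _ :: _ => simp [strict]
    | _ :: _, _ => rw [strict_eq_zero, strict_eq_zero, strict_eq_zero, add_zero] <;> simp
  map_smul l r c x := by
    match l, r with
    | [], [] => exact f.map_smul c x
    | [], _ :: _ => simp [strict]
    | _ :: _, _ => rw [strict_eq_zero, strict_eq_zero, smul_zero] <;> simp

theorem length_select_ne_one {X κ : Type*} [DecidableEq κ] {n : ℕ} (c : Fin n → κ) (a : Fin n → X)
    {i j : Fin n} (hij : i ≠ j) (h : c i = c j) : (select c (c i) a).length ≠ 1 := by
  intro hl
  rw [select, List.length_map, List.length_eq_one_iff] at hl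
  obtain ⟨k, hk⟩ := hl
  have hi : i ∈ (List.finRange n).filter fun m => c m = c i := by simp
  have hj : j ∈ (List.finRange n).filter fun m => c m = c i := by simp [h]
  rw [hk, List.mem_singleton] at hi hj
  exact hij (hi.trans hj.symm)

theorem select_id {X : Type*} {n : ℕ} (s : Fin n) (a : Fin n → X) : select id s a = [a s] := by
  have : (List.finRange n).filter (fun i => id i = s) = [s] := by
    have hn := (List.nodup_finRange n).filter fun i => decide (id i = s)
    refine List.perm_singleton.1 ((List.perm_ext_iff_of_nodup hn (List.nodup_singleton s)).2 ?_)
    simp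
  rw [select, this, List.map_singleton]

theorem koszulSign_id {n : ℕ} (p : Fin n → ZMod 2) : koszulSign p id = 1 := by
  refine Finset.prod_eq_one fun i _ => Finset.prod_eq_one fun j _ => if_neg ?_
  exact fun h => lt_asymm h.1 h.2

theorem isPartition_id {n : ℕ} : IsPartition (id : Fin n → Fin n) :=
  ⟨Function.surjective_id, fun s _ h => ⟨s, rfl, fun _ hj => h.trans_eq hj.symm⟩⟩

/-- For one-element blocks, numbering by least elements makes `c` strictly increasing, and a
strictly increasing surjection is the identity. -/
theorem IsPartition.eq_id {n : ℕ} {c : Fin n → Fin n} (hc : IsPartition c)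
    (hi : Function.Injective c) : c = id := by
  have hm : StrictMono c := by
    intro i j hij
    refine lt_of_not_ge fun hle => ?_
    obtain ⟨k, hk, hk'⟩ := hc.2 _ _ (lt_of_le_of_ne hle fun e => hij.ne' (hi e))
    exact lt_asymm hij (hi hk ▸ hk' i rfl)
  exact (hm.range_inj strictMono_id).1 (by rw [hc.1.range_eq, Set.range_id])

/-- Substituting a strict family. -/
theorem substitute_strict_right {ψ : List Y → Z} (hψ : IsMultilinearFamily (𝕜 := 𝕜) ψ)
    (f : X →ₗ[𝕜] Y) {n : ℕ} (p : Fin n → ZMod 2) (a : Fin n → X) :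
    substitute ψ (strict f) p a = ψ (List.ofFn (f ∘ a)) := by
  -- A repeated label gives a block with at least two elements, on which a strict family vanishes;
  -- so only the partition into singletons survives.
  have key : ∀ {r : ℕ} (c : Fin n → Fin r), ¬ Function.Injective c →
      ψ (List.ofFn fun s => strict f (select c s a)) = 0 := by
    intro r c hc
    obtain ⟨i, j, h, hij⟩ : ∃ i j, c i = c j ∧ i ≠ j := by
      simpa [Function.Injective] using hc
    refine hψ.map_zero (List.mem_ofFn.2 ⟨c i, ?_⟩)
    exact strict_eq_zero f (length_select_ne_one c a hij h)
  rw [substitute, Finset.sum_eq_single n]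
  · rw [Finset.sum_eq_single id]
    · simp only [isPartition_id, if_true, koszulSign_id, one_smul, select_id, strict_singleton]
      rfl
    · intro c _ hc
      split_ifs with h
      · rw [key c fun hi => hc (h.eq_id hi), smul_zero]
      · rfl
    · simp
  · intro r _ hr
    refine Finset.sum_eq_zero fun c _ => ?_
    split_ifs with h
    · rw [key c, smul_zero]
      intro hi
      have := Fintype.card_of_bijective ⟨hi, h.1⟩
      simp only [Fintype.card_fin] at this
      exact hr this.symm
    · rfl
  · simp

/-- Substituting into a strict family. -/
theorem substitute_strict_left {X : Type*} (g : Y →ₗ[𝕜] Z) {φ : List X → Y} (hφ : φ [] = 0) {n : ℕ}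
    (p : Fin n → ZMod 2) (a : Fin n → X) :
    substitute (strict g) φ p a = g (φ (List.ofFn a)) := by
  -- Without arguments there is no one-block partition: the only term is the empty one, and both
  -- sides are zero because `φ [] = 0`.
  obtain _ | n := n
  · simp [substitute, strict, hφ]
  have h1 : ∀ c : Fin (n + 1) → Fin 1, IsPartition c := fun c =>
    ⟨fun s => ⟨0, Subsingleton.elim _ _⟩, fun s t h => absurd h (by simp [Subsingleton.elim s t])⟩
  rw [substitute, Finset.sum_eq_single 1]
  · rw [Finset.sum_eq_single 0]
    · rw [if_pos (h1 _)]
      have : select (0 : Fin (n + 1) → Fin 1) 0 a = List.ofFn a := by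
        simp [select, -List.ofFn_succ, List.ofFn_eq_map]
      simp [koszulSign, this, -List.ofFn_succ, List.ofFn_succ (n := 0)]
    · exact fun c _ hc => absurd (Subsingleton.elim _ _) hc
    · exact fun h => absurd (Finset.mem_univ _) h
  · intro r _ hr
    refine Finset.sum_eq_zero fun c _ => ?_
    rw [strict_eq_zero g (by simpa using hr), smul_zero, ite_self]
  · simp

theorem map_substitute {X Y W : Type*} [AddCommGroup W] [Module 𝕜 W] (g : Z →ₗ[𝕜] W) (ψ : List Y → Z)
    (φ : List X → Y) {n : ℕ} (p : Fin n → ZMod 2) (a : Fin n → X) :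
    g (substitute ψ φ p a) = substitute (fun l => g (ψ l)) φ p a := by
  simp only [substitute, map_sum, apply_ite g, map_zero, map_intUnits_smul]

theorem substitute_linearMap_comp {X : Type*} (g : Y →ₗ[𝕜] Z) {W : Type*} [AddCommGroup W] (ψ : List Z → W)
    (φ : List X → Y) {n : ℕ} (p : Fin n → ZMod 2) (a : Fin n → X) :
    substitute ψ (fun l => g (φ l)) p a = substitute (fun l => ψ (l.map g)) φ p a := by
  simp only [substitute, List.map_ofFn, Function.comp_def]

end Strict

/-! ### Jacobiators on lists of homogeneous elements. -/

section Jacobiator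

variable {𝕜 : Type u} [Field 𝕜] {X : Type*} [AddCommGroup X] [Module 𝕜 X]
  (gr : ZMod 2 → Submodule 𝕜 X)

/-- The list of the underlying elements of a list of homogeneous elements. -/
abbrev values (l : List (Σ p, gr p)) : List X := l.map fun z => z.2.1

/-- The Jacobiator as a function of a list of homogeneous elements. -/
def jacobiatorList (f : List X → X) (l : List (Σ p, gr p)) : X :=
  unshuffleSum Sigma.fst (fun s t => f (f (values gr s) :: values gr t)) l

variable {gr} {f : List X → X}

theorem jacobiatorList_symm (hm : IsMultilinearFamily (𝕜 := 𝕜) f) (hs : IsGradedSymmetric gr f)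
    (l r : List (Σ p, gr p)) (x y : Σ p, gr p) :
    jacobiatorList gr f (l ++ x :: y :: r) =
      ((-1 : ℤˣ) ^ (x.1 * y.1)) • jacobiatorList gr f (l ++ y :: x :: r) := by
  refine unshuffleSum_symm _ (fun l r x y t => ?_) (fun s l r x y => ?_) l r x y
  · simp only [values, List.map_append, List.map_cons]
    rw [hs _ _ _ _ _ _ x.2.2 y.2.2]
    exact hm.map_intUnits_smul [] _ _ _
  · simp only [values, List.map_append, List.map_cons]
    exact hs (_ :: _) _ _ _ _ _ x.2.2 y.2.2

theorem jacobiatorList_add (hm : IsMultilinearFamily (𝕜 := 𝕜) f) (l r : List (Σ p, gr p))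
    {p : ZMod 2} (y z : gr p) :
    jacobiatorList gr f (l ++ ⟨p, y + z⟩ :: r) =
      jacobiatorList gr f (l ++ ⟨p, y⟩ :: r) + jacobiatorList gr f (l ++ ⟨p, z⟩ :: r) := by
  refine unshuffleSum_additive (x := (⟨p, y + z⟩ : Σ p, gr p)) (y := ⟨p, y⟩) (z := ⟨p, z⟩)
    Sigma.fst rfl rfl (fun l r t => ?_) (fun s l r => ?_) l r
  · simp only [values, List.map_append, List.map_cons, Submodule.coe_add]
    rw [hm.map_add]
    exact hm.map_add [] (values gr t) _ _
  · simp only [values, List.map_append, List.map_cons, Submodule.coe_add]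
    exact hm.map_add (_ :: _) _ _ _

end Jacobiator

/-! ### Strict morphisms, subalgebras and fibers. -/

section Bracket

variable {𝕜 : Type u} [Field 𝕜]

namespace BracketSpace

theorem sum_labellings_eq (A : BracketSpace.{u, v} 𝕜) {Y : Type*} [AddCommGroup Y]
    (F : List A.carrier → List A.carrier → Y) {n : ℕ} (p : Fin n → ZMod 2) (a : Fin n → A.carrier)
    (h : ∀ i, a i ∈ A.gr (p i)) :
    ∑ c : Fin n → Fin 2, koszulSign p c • F (select c 0 a) (select c 1 a) =
      unshuffleSum Sigma.fst (fun s t => F (values A.gr s) (values A.gr t))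
        (List.ofFn fun i => (⟨p i, a i, h i⟩ : Σ p, A.gr p)) := by
  rw [← sum_koszulSign_smul]
  simp only [map_select]
  rfl

theorem jacobiator_eq (A : BracketSpace.{u, v} 𝕜) {n : ℕ} (p : Fin n → ZMod 2)
    (a : Fin n → A.carrier) (h : ∀ i, a i ∈ A.gr (p i)) :
    A.jacobiator p a = jacobiatorList A.gr A.bracket (List.ofFn fun i => ⟨p i, a i, h i⟩) :=
  A.sum_labellings_eq (fun s t => A.bracket (A.bracket s :: t)) p a h

theorem isLInfinityAlgebra_of_list {A : BracketSpace.{u, v} 𝕜} (hc : IsCompl (A.gr 0) (A.gr 1))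
    (hm : IsMultilinearFamily (𝕜 := 𝕜) A.bracket) (hs : IsGradedSymmetric A.gr A.bracket)
    (ho : HasParity A.gr A.gr 1 A.bracket) (hj : ∀ l, jacobiatorList A.gr A.bracket l = 0) :
    A.IsLInfinityAlgebra :=
  ⟨hc, hm, hs, ho, fun _ p a h => (A.jacobiator_eq p a h).trans (hj _)⟩

variable {A B : BracketSpace.{u, v} 𝕜}

theorem map_jacobiator (f : A.carrier →ₗ[𝕜] B.carrier)
    (hf : ∀ l, f (A.bracket l) = B.bracket (l.map f)) {n : ℕ} (p : Fin n → ZMod 2)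
    (a : Fin n → A.carrier) : f (A.jacobiator p a) = B.jacobiator p (f ∘ a) := by
  simp only [jacobiator, map_sum, map_intUnits_smul, hf, List.map_cons, map_select]

/-- A graded subspace closed under the brackets of an `L∞`-algebra is an `L∞`-algebra. -/
theorem IsLInfinityAlgebra.of_injective (hB : B.IsLInfinityAlgebra)
    (f : A.carrier →ₗ[𝕜] B.carrier) (hi : Function.Injective f)
    (hgr : ∀ p x, x ∈ A.gr p ↔ f x ∈ B.gr p) (hf : ∀ l, f (A.bracket l) = B.bracket (l.map f))
    (hc : IsCompl (A.gr 0) (A.gr 1)) : A.IsLInfinityAlgebra where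
  isCompl := hc
  multilinear :=
    { map_add := fun l r x y => hi (by
        simp only [hf, map_add, List.map_append, List.map_cons]
        exact hB.multilinear.map_add _ _ _ _)
      map_smul := fun l r c x => hi (by
        simp only [hf, map_smul, List.map_append, List.map_cons]
        exact hB.multilinear.map_smul _ _ _ _) }
  symmetric l r p q x y hx hy := hi (by
    simp only [hf, map_intUnits_smul, List.map_append, List.map_cons]
    exact hB.symmetric _ _ _ _ _ _ ((hgr _ _).1 hx) ((hgr _ _).1 hy))
  odd l p h := by
    rw [hgr, hf]
    exact hB.odd _ _ (List.forall₂_map_left_iff.2 (h.imp fun x i => (hgr i x).1))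
  jacobi n p a h := hi (by
    rw [map_jacobiator f hf, map_zero]
    exact hB.jacobi n p _ fun i => (hgr _ _).1 (h i))

/-- A linear map that preserves the grading and the brackets is a strict `L∞`-morphism. -/
theorem isLInfinityMorphism_strict (hB : IsMultilinearFamily (𝕜 := 𝕜) B.bracket)
    (f : A.carrier →ₗ[𝕜] B.carrier) (hgr : ∀ p, ∀ x ∈ A.gr p, f x ∈ B.gr p)
    (hf : ∀ l, f (A.bracket l) = B.bracket (l.map f)) :
    IsLInfinityMorphism A B (strict f) where
  zero := rfl
  multilinear := strict_isMultilinearFamily f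
  symmetric l r p q x y _ _ := by
    rw [strict_eq_zero, strict_eq_zero, smul_zero] <;> simp <;> omega
  even l p h := by
    match h with
    | .nil => exact zero_mem _
    | .cons h .nil => simpa using hgr _ _ h
    | .cons _ (.cons _ _) => exact zero_mem _
  intertwines n p a h := by
    rw [substitute_strict_right hB, A.sum_labellings_eq (fun s t => strict f (A.bracket s :: t)),
      unshuffleSum_nil_right]
    · simp only [List.map_nil, strict_singleton, hf, List.map_ofFn]
      rfl
    · exact fun x s t => rfl
    · exact h

theorem isComposite_strict {C : BracketSpace.{u, v} 𝕜} (g : B.carrier →ₗ[𝕜] C.carrier)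
    (f : A.carrier →ₗ[𝕜] B.carrier) :
    IsComposite (A := A) (B := B) (C := C) (strict g) (strict f) (strict (g.comp f)) := by
  intro n p a _
  rw [substitute_strict_right (strict_isMultilinearFamily g), ← strict_map, List.map_ofFn]

/-- The kernel of a strict surjection, included by a strict morphism, is the fiber. -/
theorem isFiber_strict {F Z Y : BracketSpace.{u, v} 𝕜} (hF : F.IsLInfinityAlgebra)
    (hZ : IsMultilinearFamily (𝕜 := 𝕜) Z.bracket) (ι : F.carrier →ₗ[𝕜] Z.carrier)
    (p : Z.carrier →ₗ[𝕜] Y.carrier) (ρ : Z.carrier →ₗ[𝕜] F.carrier)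
    (hρ : ∀ x, ρ (ι x) = x) (hgr : ∀ q, ∀ x ∈ F.gr q, ι x ∈ Z.gr q)
    (hρgr : ∀ q, ∀ x ∈ Z.gr q, ρ x ∈ F.gr q)
    (hι : ∀ l, ι (F.bracket l) = Z.bracket (l.map ι)) (hpι : p.comp ι = 0)
    (hker : ∀ z, p z = 0 → ι (ρ z) = z) :
    IsFiber F Z Y (strict ι) (strict p) where
  fiber := hF
  morphism_ι := isLInfinityMorphism_strict hZ ι hgr hι
  comp n q a h := by
    rw [isComposite_strict p ι n q a h, hpι]
    generalize List.ofFn a = l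
    match l with
    | [] => rfl
    | [x] => rfl
    | _ :: _ :: _ => rfl
  universal W φ hW hφ hpφ := by
    -- The vanishing of the composite is known only on homogeneous arguments; multilinearity extends
    -- it to all.
    have hp : ∀ l, p (φ l) = 0 := by
      refine congrFun ((hφ.multilinear.comp_linearMap p).ext_homogeneous
        isMultilinearFamily_zero hW.isCompl fun n q a h => ?_)
      rw [← substitute_strict_left p hφ.zero q a]
      exact hpφ n q a h
    have hιρ : ∀ l, ι (ρ (φ l)) = φ l := fun l => hker _ (hp l)
    have hφ' : φ = fun l => ι (ρ (φ l)) := funext fun l => (hιρ l).symm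
    refine ⟨fun l => ρ (φ l), ⟨⟨?_, hφ.multilinear.comp_linearMap ρ, ?_, ?_, ?_⟩, ?_⟩, ?_⟩
    · simp only [hφ.zero, map_zero]
    · intro l r p q x y hx hy
      simp only [hφ.symmetric l r p q x y hx hy, map_intUnits_smul]
    · exact fun l p h => hρgr _ _ (hφ.even l p h)
    · intro n q a h
      -- The retraction `ρ` need not respect the brackets of `Z`. Writing `φ` inside the brackets as
      -- `ι ∘ ρ ∘ φ` lets `ι` be pulled out of them, after which `ρ` cancels it.
      have := congrArg ρ (hφ.intertwines n q a h)
      rw [hφ', substitute_linearMap_comp, ← hφ'] at this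
      simp only [← hι, map_sum, map_intUnits_smul, map_substitute, hρ] at this
      exact this
    · intro n q a h
      rw [substitute_strict_left ι (by simp only [hφ.zero, map_zero]), hιρ]
    · rintro ψ ⟨hψ, hψ'⟩
      refine hψ.multilinear.ext_homogeneous (hφ.multilinear.comp_linearMap ρ) hW.isCompl
        fun n q a h => ?_
      rw [← hψ' n q a h, substitute_strict_left ι hψ.zero, hρ]

end BracketSpace

end Bracket

end DerivedBrackets

namespace DerivedBrackets

namespace DiffLieSuperalgebra

variable {𝕜 : Type u} [Field 𝕜] {L : Type v} [AddCommGroup L] [Module 𝕜 L]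
  (A : DiffLieSuperalgebra 𝕜 L)

theorem zmod_two_cases (p : ZMod 2) : p = 0 ∨ p = 1 := by
  revert p; decide

/-! ### Parity and brackets in a Lie superalgebra. -/

section Parity

theorem evenPart_of_mem {p : ZMod 2} {x : L} (hx : x ∈ A.gr p) :
    A.evenPart x = if p = 0 then x else 0 := by
  rcases zmod_two_cases p with rfl | rfl
  · exact Submodule.projection_apply_of_mem_left A.isCompl hx
  · exact Submodule.projection_apply_of_mem_right A.isCompl hx

theorem oddPart_of_mem {p : ZMod 2} {x : L} (hx : x ∈ A.gr p) :
    A.oddPart x = if p = 1 then x else 0 := by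
  rcases zmod_two_cases p with rfl | rfl
  · exact Submodule.projection_apply_of_mem_right A.isCompl.symm hx
  · exact Submodule.projection_apply_of_mem_left A.isCompl.symm hx

theorem parity_of_mem {p : ZMod 2} {x : L} (hx : x ∈ A.gr p) :
    A.parity x = ((-1 : ℤˣ) ^ p) • x := by
  rw [parity, LinearMap.sub_apply, A.evenPart_of_mem hx, A.oddPart_of_mem hx]
  rcases zmod_two_cases p with rfl | rfl <;> simp [Units.neg_smul]

theorem exists_add (x : L) : ∃ y ∈ A.gr 0, ∃ z ∈ A.gr 1, y + z = x :=
  Submodule.mem_sup.1 (A.isCompl.sup_eq_top ▸ Submodule.mem_top)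

/-- A linear relation may be checked on homogeneous elements. -/
theorem linearMap_ext {M : Type*} [AddCommGroup M] [Module 𝕜 M] {f g : L →ₗ[𝕜] M}
    (h : ∀ p, ∀ x ∈ A.gr p, f x = g x) : f = g := by
  ext x
  obtain ⟨y, hy, z, hz, rfl⟩ := A.exists_add x
  rw [map_add, map_add, h _ y hy, h _ z hz]

theorem intUnits_smul_mem {S : Submodule 𝕜 L} (u : ℤˣ) {x : L} (hx : x ∈ S) : u • x ∈ S := by
  rw [Units.smul_def]
  exact zsmul_mem hx _

theorem parity_mem {p : ZMod 2} {x : L} (hx : x ∈ A.gr p) : A.parity x ∈ A.gr p := by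
  rw [A.parity_of_mem hx]
  exact intUnits_smul_mem _ hx

theorem br_intUnits_smul (u : ℤˣ) (x y : L) : A.br (u • x) y = u • A.br x y :=
  map_intUnits_smul (A.br.flip y) u x

theorem br_swap {p q : ZMod 2} {x y : L} (hx : x ∈ A.gr p) (hy : y ∈ A.gr q) :
    A.br x y = ((-1 : ℤˣ) ^ (p * q + 1)) • A.br y x := by
  rw [A.br_antisymm p q x y hx hy, neg_sign_smul]

/-- The Jacobi identity, for a bracketing from the left. -/
theorem br_br {p q r : ZMod 2} {x y z : L} (hx : x ∈ A.gr p) (hy : y ∈ A.gr q) (hz : z ∈ A.gr r) :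
    A.br (A.br x y) z = A.br x (A.br y z) + ((-1 : ℤˣ) ^ (q * r)) • A.br (A.br x z) y := by
  have key : ∀ p q r : ZMod 2, p * q + (q * (p + r) + 1) + 1 = q * r := by decide
  rw [A.jacobi p q x y z hx hy, A.br_swap hy (A.br_mem _ _ _ _ hx hz), sign_smul_smul,
    ← key p q r, ← neg_sign_smul]
  abel

end Parity

/-! ### The L∞-algebra ΠL. -/

section Shift

/-- The brackets of the parity shift. -/
noncomputable def shiftBracket : List L → L := A.shift.bracket

@[simp] theorem shiftBracket_nil : A.shiftBracket [] = 0 := rfl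

@[simp] theorem shiftBracket_singleton (x : L) : A.shiftBracket [x] = -A.D x := rfl

@[simp] theorem shiftBracket_pair (x y : L) : A.shiftBracket [x, y] = A.br (A.parity x) y := rfl

@[simp] theorem shiftBracket_cons₃ (x y z : L) (l : List L) :
    A.shiftBracket (x :: y :: z :: l) = 0 := rfl

theorem shiftBracket_eq_zero {l : List L} (h₁ : l.length ≠ 1) (h₂ : l.length ≠ 2) :
    A.shiftBracket l = 0 := by
  match l with
  | [] => rfl
  | [_] => simp at h₁
  | [_, _] => simp at h₂
  | _ :: _ :: _ :: _ => rfl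

theorem shift_isMultilinearFamily : IsMultilinearFamily (𝕜 := 𝕜) A.shiftBracket where
  map_add l r x y := by
    match l, r with
    | [], [] => simp [add_comm]
    | [], [_] => simp
    | [], _ :: _ :: _ => simp
    | [_], [] => simp
    | [_], _ :: _ => simp
    | [_, _], _ => simp
    | _ :: _ :: _ :: _, _ => simp
  map_smul l r c x := by
    match l, r with
    | [], [] => simp
    | [], [_] => simp
    | [], _ :: _ :: _ => simp
    | [_], [] => simp
    | [_], _ :: _ => simp
    | [_, _], _ => simp
    | _ :: _ :: _ :: _, _ => simp

theorem shift_isGradedSymmetric :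
    IsGradedSymmetric (fun p => A.gr (p + 1)) A.shiftBracket := by
  intro l r p q x y hx hy
  match l, r with
  | [], [] =>
    have key : ∀ p q : ZMod 2, p + 1 + ((p + 1) * (q + 1) + 1) = p * q + (q + 1) := by decide
    simp only [List.nil_append, shiftBracket_pair]
    rw [A.parity_of_mem hx, A.parity_of_mem hy, br_intUnits_smul, br_intUnits_smul,
      A.br_swap hx hy, sign_smul_smul, sign_smul_smul, key]
  | [], _ :: _ => simp
  | [_], _ => simp
  | [_, _], _ => simp
  | _ :: _ :: _ :: _, _ => simp

theorem shift_hasParity :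
    HasParity (fun p => A.gr (p + 1)) (fun p => A.gr (p + 1)) 1 A.shiftBracket := by
  intro l p h
  match h with
  | .nil => exact zero_mem _
  | .cons (a := x) (b := p) h .nil =>
    have := neg_mem (A.D_odd _ _ h)
    simpa [add_comm] using this
  | .cons (a := x) (b := p) h (.cons (a := y) (b := q) h' .nil) =>
    have := A.br_mem _ _ _ _ (A.parity_mem h) h'
    have e : p + 1 + (q + 1) = 1 + (p + q) + 1 := by ring
    rw [e] at this
    simpa using this
  | .cons _ (.cons _ (.cons _ _)) => exact zero_mem _

theorem br_parity {p : ZMod 2} {x : L} (hx : x ∈ A.gr p) (y : L) :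
    A.br (A.parity x) y = ((-1 : ℤˣ) ^ p) • A.br x y := by
  rw [A.parity_of_mem hx, br_intUnits_smul]

theorem br_parity_br {p q : ZMod 2} {x y : L} (hx : x ∈ A.gr p) (hy : y ∈ A.gr q) (z : L) :
    A.br (A.parity (A.br (A.parity x) y)) z = ((-1 : ℤˣ) ^ q) • A.br (A.br x y) z := by
  have key : ∀ p q : ZMod 2, p + q + p = q := by decide
  rw [A.br_parity (A.br_mem _ _ _ _ (A.parity_mem hx) hy), A.br_parity hx, br_intUnits_smul,
    sign_smul_smul, key]

/-- Arity 1 is D² = 0, arity 2 the Leibniz rule, arity 3 the Jacobi identity. From arity 4 on, an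
inner bracket of one or two arguments leaves at least three for the outer one. -/
theorem shift_jacobi (l : List (Σ p, A.gr (p + 1))) :
    jacobiatorList (fun p => A.gr (p + 1)) A.shiftBracket l = 0 := by
  match l with
  | [] => simp [jacobiatorList, unshuffleSum]
  | [⟨p, x, hx⟩] => simp [jacobiatorList, unshuffleSum, A.D_sq]
  | [⟨p, x, hx⟩, ⟨q, y, hy⟩] =>
    simp only [jacobiatorList, unshuffleSum, values, List.map_cons, List.map_nil,
      shiftBracket_nil, shiftBracket_singleton, shiftBracket_pair, totalParity_nil,
      totalParity_cons]
    rw [A.br_parity hx, A.br_parity (neg_mem (A.D_odd _ _ hx)),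
      A.br_parity (neg_mem (A.D_odd _ _ hy)), map_intUnits_smul, A.D_leibniz _ _ _ hx, map_neg,
      map_neg, LinearMap.neg_apply, LinearMap.neg_apply, A.br_swap (A.D_odd _ _ hy) hx]
    rcases zmod_two_cases p with rfl | rfl <;> rcases zmod_two_cases q with rfl | rfl <;>
      simp [show (1 : ZMod 2) + 1 = 0 from rfl]
  | [⟨p, x, hx⟩, ⟨q, y, hy⟩, ⟨r, z, hz⟩] =>
    simp only [jacobiatorList, unshuffleSum, values, List.map_cons, List.map_nil,
      shiftBracket_nil, shiftBracket_singleton, shiftBracket_pair, totalParity_nil,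
      totalParity_cons, shiftBracket_cons₃]
    rw [A.br_parity_br hx hy, A.br_parity_br hx hz, A.br_parity_br hy hz, A.br_br hx hy hz,
      A.br_swap (A.br_mem _ _ _ _ hy hz) hx]
    rcases zmod_two_cases p with rfl | rfl <;> rcases zmod_two_cases q with rfl | rfl <;>
      rcases zmod_two_cases r with rfl | rfl <;> simp [show (1 : ZMod 2) + 1 = 0 from rfl]
  | _ :: _ :: _ :: _ :: l =>
    refine unshuffleSum_eq_zero_of_length _ fun s t e => ?_
    simp only [List.length_cons] at e
    by_cases h : s.length = 1 ∨ s.length = 2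
    · exact A.shiftBracket_eq_zero (by rw [List.length_cons, List.length_map]; omega)
        (by rw [List.length_cons, List.length_map]; omega)
    · rw [A.shiftBracket_eq_zero (l := values _ s) (by rw [List.length_map]; omega)
        (by rw [List.length_map]; omega)]
      exact A.shift_isMultilinearFamily.map_zero (by simp)

theorem shift_isLInfinityAlgebra : A.shift.IsLInfinityAlgebra :=
  BracketSpace.isLInfinityAlgebra_of_list (A := A.shift) A.isCompl.symm A.shift_isMultilinearFamily
    A.shift_isGradedSymmetric A.shift_hasParity A.shift_jacobi

end Shift

end DiffLieSuperalgebra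

end DerivedBrackets

namespace DerivedBrackets

namespace DiffLieSuperalgebra

variable {𝕜 : Type u} [Field 𝕜] {L : Type v} [AddCommGroup L] [Module 𝕜 L]
  (A : DiffLieSuperalgebra 𝕜 L)

/-! ### Iterated brackets and the projected Leibniz identity. -/

section Nested

@[simp] theorem nested_nil (x : L) : A.nested x [] = x := rfl

@[simp] theorem nested_cons (x a : L) (l : List L) :
    A.nested x (a :: l) = A.nested (A.br x a) l := rfl

/-- The nested bracket as a linear map in its first argument. -/
def nestedHom : List L → L →ₗ[𝕜] L
  | [] => LinearMap.id
  | a :: l => nestedHom l ∘ₗ A.br.flip a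

theorem nestedHom_apply (l : List L) (x : L) : A.nestedHom l x = A.nested x l := by
  induction l generalizing x with
  | nil => rfl
  | cons a l ih => exact ih _

@[simp] theorem nested_zero (l : List L) : A.nested 0 l = 0 := by
  rw [← nestedHom_apply, map_zero]

theorem nested_add (x y : L) (l : List L) :
    A.nested (x + y) l = A.nested x l + A.nested y l := by
  simp only [← nestedHom_apply, map_add]

theorem nested_intUnits_smul (u : ℤˣ) (x : L) (l : List L) :
    A.nested (u • x) l = u • A.nested x l := by
  simp only [← nestedHom_apply, map_intUnits_smul]

variable {V : Submodule 𝕜 L} (hVbr : ∀ a ∈ V, ∀ b ∈ V, A.br a b = 0)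

include hVbr in
-- Since [a, b] = 0, the Jacobi identity makes the right bracketings by `a` and `b` commute up to
-- sign.
theorem br_br_comm {p q : ZMod 2} {a b : L} (ha : a ∈ A.gr p) (hb : b ∈ A.gr q) (haV : a ∈ V)
    (hbV : b ∈ V) (x : L) :
    A.br (A.br x a) b = ((-1 : ℤˣ) ^ (p * q)) • A.br (A.br x b) a := by
  suffices A.br.flip b ∘ₗ A.br.flip a =
      (DistribSMul.toLinearMap 𝕜 L ((-1 : ℤˣ) ^ (p * q))) ∘ₗ A.br.flip a ∘ₗ A.br.flip b from
    LinearMap.congr_fun this x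
  refine A.linearMap_ext fun r x hx => ?_
  simp only [LinearMap.comp_apply, LinearMap.flip_apply, DistribSMul.toLinearMap_apply]
  rw [A.br_br hx ha hb, hVbr a haV b hbV, map_zero, zero_add]

variable {α : Type*} {par : α → ZMod 2} {val : α → L} (hval : ∀ z, val z ∈ A.gr (par z))

include hval in
theorem nested_mem {p : ZMod 2} {x : L} (hx : x ∈ A.gr p) (l : List α) :
    A.nested x (l.map val) ∈ A.gr (p + totalParity par l) := by
  induction l generalizing p x with
  | nil => simpa using hx
  | cons a l ih =>
    have := ih (A.br_mem _ _ _ _ hx (hval a))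
    rwa [add_assoc] at this

include hval in
/-- The Leibniz rule for the nested bracket. -/
theorem nested_br {p q : ZMod 2} {x y : L} (hx : x ∈ A.gr p) (hy : y ∈ A.gr q) (l : List α) :
    A.nested (A.br x y) (l.map val) =
      unshuffleSum par (fun s t => ((-1 : ℤˣ) ^ (q * totalParity par s)) •
        A.br (A.nested x (s.map val)) (A.nested y (t.map val))) l := by
  induction l generalizing p q x y with
  | nil => simp [unshuffleSum]
  | cons a l ih =>
    simp only [List.map_cons, nested_cons, unshuffleSum]
    rw [A.br_br hx hy (hval a), nested_add, nested_intUnits_smul,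
      ih hx (A.br_mem _ _ _ _ hy (hval a)), ih (A.br_mem _ _ _ _ hx (hval a)) hy,
      ← unshuffleSum_smul, add_comm]
    have k : ∀ p q s : ZMod 2, q * p + q * s = q * (p + s) ∧ p * s + q * s = (q + p) * s := by
      decide
    simp only [sign_smul_smul, totalParity_cons, k]

include hVbr hval in
theorem nested_br_comm {p : ZMod 2} {b : L} (hb : b ∈ A.gr p) (hbV : b ∈ V)
    (hV : ∀ z, val z ∈ V) (x : L) (l : List α) :
    A.nested (A.br x b) (l.map val) =
      ((-1 : ℤˣ) ^ (p * totalParity par l)) • A.br (A.nested x (l.map val)) b := by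
  induction l generalizing x with
  | nil => simp
  | cons a l ih =>
    simp only [List.map_cons, nested_cons, totalParity_cons]
    rw [A.br_br_comm hVbr hb (hval a) hbV (hV a), nested_intUnits_smul, ih, sign_smul_smul, mul_add]

include hVbr hval in
/-- The identity behind the `L∞`-relations: `P[x, y] = P[Px, y] + P[x, Py]`, expanded by the
Leibniz rule. -/
theorem projected_nested_identity (T : L →ₗ[𝕜] L) (hTV : ∀ x, T x ∈ V)
    (hTgr : ∀ p, ∀ x ∈ A.gr p, T x ∈ A.gr p)
    (hT : ∀ x y, T (A.br x y) = T (A.br (T x) y) + T (A.br x (T y)))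
    (hV : ∀ z, val z ∈ V) {p q : ZMod 2} {x y : L} (hx : x ∈ A.gr (p + 1))
    (hy : y ∈ A.gr (q + 1)) (l : List α) :
    ((-1 : ℤˣ) ^ (p + 1)) • T (A.nested (A.br x y) (l.map val)) +
      unshuffleSum par (fun s t => ((-1 : ℤˣ) ^ (p * q + q)) •
        T (A.nested (A.br y (T (A.nested x (s.map val)))) (t.map val))) l +
      unshuffleSum par (fun s t => ((-1 : ℤˣ) ^ p) •
        T (A.nested (A.br x (T (A.nested y (s.map val)))) (t.map val))) l = 0 := by
  have k₁ : ∀ p q s t : ZMod 2, (q + 1) * s + ((p + 1 + s) * (q + 1 + t) + 1) =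
      p * q + q + (p + 1) + 1 + (p + 1 + s) * t := by decide
  have k₂ : ∀ q s t : ZMod 2, s * t + (q + 1) * t = (q + 1 + s) * t := by decide
  have k₃ : ∀ p q : ZMod 2, p + 1 + (p * q + q + (p + 1) + 1) = p * q + q + 1 := by decide
  have h := congrArg T (A.nested_br hval hx hy l)
  rw [map_unshuffleSum] at h
  -- Each Leibniz term [x_S, y_T] splits into a part with Tx_S and a part with Ty_T; these become
  -- the two sums of the claim.
  have e₀ : ∀ s t : List α, T (A.br (A.nested x (s.map val)) (A.nested y (t.map val))) =
      T (A.br (T (A.nested x (s.map val))) (A.nested y (t.map val))) +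
        T (A.br (A.nested x (s.map val)) (T (A.nested y (t.map val)))) := fun s t => hT _ _
  simp only [map_intUnits_smul, e₀, smul_add] at h
  rw [unshuffleSum_add] at h
  have e₁ : ∀ s t : List α, ((-1 : ℤˣ) ^ ((q + 1) * totalParity par s)) •
      T (A.br (T (A.nested x (s.map val))) (A.nested y (t.map val))) =
      ((-1 : ℤˣ) ^ (p * q + q + (p + 1) + 1)) •
        T (A.nested (A.br y (T (A.nested x (s.map val)))) (t.map val)) := by
    intro s t
    have h₁ := hTgr _ _ (A.nested_mem hval hx s)
    rw [A.nested_br_comm hVbr hval h₁ (hTV _) hV, A.br_swap h₁ (A.nested_mem hval hy t),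
      map_intUnits_smul, map_intUnits_smul, sign_smul_smul, sign_smul_smul, k₁]
  -- In this part the inner expression uses the second block of the unshuffle, so the blocks are
  -- exchanged by `unshuffleSum_comm` before comparing.
  have e₂ : ∀ s t : List α, ((-1 : ℤˣ) ^ (totalParity par s * totalParity par t)) •
      ((-1 : ℤˣ) ^ ((q + 1) * totalParity par t)) •
      T (A.br (A.nested x (t.map val)) (T (A.nested y (s.map val)))) =
        T (A.nested (A.br x (T (A.nested y (s.map val)))) (t.map val)) := by
    intro s t
    have h₁ := hTgr _ _ (A.nested_mem hval hy s)
    rw [A.nested_br_comm hVbr hval h₁ (hTV _) hV, map_intUnits_smul, sign_smul_smul, k₂]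
  rw [unshuffleSum_comm par (fun s t => _ • T (A.br (A.nested x _) _))] at h
  simp only [e₁, e₂] at h
  simp only [unshuffleSum_smul] at h ⊢
  rw [h, smul_add, sign_smul_smul, k₃, ← neg_sign_smul, ← neg_sign_smul]
  abel

end Nested

/-! ### Making the derivation inner. -/

section Adjoin

theorem prod_isCompl {M : Type*} [AddCommGroup M] [Module 𝕜 M] {p q : Submodule 𝕜 L}
    {p' q' : Submodule 𝕜 M} (h : IsCompl p q) (h' : IsCompl p' q') :
    IsCompl (p.prod p') (q.prod q') := by
  constructor
  · rw [Submodule.disjoint_def]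
    exact fun x hx hy => Prod.ext (Submodule.disjoint_def.1 h.disjoint _ hx.1 hy.1)
      (Submodule.disjoint_def.1 h'.disjoint _ hx.2 hy.2)
  · rw [codisjoint_iff, Submodule.prod_sup_prod, h.sup_eq_top, h'.sup_eq_top, Submodule.prod_top]

/-- The Lie superalgebra `L ⊕ 𝕜 Δ`, where the odd element `Δ` acts on `L` as the derivation `D`. -/
noncomputable def adjoinDerivation : DiffLieSuperalgebra 𝕜 (L × 𝕜) where
  gr p := (A.gr p).prod (if p = 0 then ⊥ else ⊤)
  isCompl := prod_isCompl A.isCompl isCompl_bot_top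
  br := LinearMap.mk₂ 𝕜
    (fun x y => (A.br x.1 y.1 + x.2 • A.D y.1 - y.2 • A.D (A.parity x.1), 0))
    (fun x y z => by ext <;> simp [add_smul]; abel)
    (fun c x y => by ext <;> simp [smul_add, smul_sub, mul_smul, smul_comm c])
    (fun x y z => by ext <;> simp [add_smul]; abel)
    (fun c x y => by ext <;> simp [smul_add, smul_sub, mul_smul, smul_comm c])
  br_mem p q x y hx hy := by
    obtain ⟨x, c⟩ := x
    obtain ⟨y, d⟩ := y
    obtain ⟨hx, hc⟩ := hx
    obtain ⟨hy, hd⟩ := hy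
    refine ⟨?_, zero_mem _⟩
    have h₁ := A.br_mem _ _ _ _ hx hy
    have h₂ := A.D_odd _ _ (A.parity_mem hx)
    have h₃ := A.D_odd _ _ hy
    refine sub_mem (add_mem h₁ ?_) ?_
    · rcases zmod_two_cases p with rfl | rfl
      · simp_all
      · rw [add_comm]; exact Submodule.smul_mem _ _ h₃
    · rcases zmod_two_cases q with rfl | rfl
      · simp_all
      · exact Submodule.smul_mem _ _ h₂
  br_antisymm p q x y hx hy := by
    obtain ⟨x, c⟩ := x
    obtain ⟨y, d⟩ := y
    obtain ⟨hx, hc⟩ := hx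
    obtain ⟨hy, hd⟩ := hy
    dsimp only at hx hc hy hd
    simp only [LinearMap.mk₂_apply]
    rw [A.br_antisymm p q x y hx hy, A.parity_of_mem hx, A.parity_of_mem hy]
    rcases zmod_two_cases p with rfl | rfl <;> rcases zmod_two_cases q with rfl | rfl <;>
      simp_all [Units.neg_smul] <;> abel
  jacobi p q x y z hx hy := by
    obtain ⟨x, c⟩ := x
    obtain ⟨y, d⟩ := y
    obtain ⟨z, e⟩ := z
    obtain ⟨hx, hc⟩ := hx
    obtain ⟨hy, hd⟩ := hy
    dsimp only at hx hc hy hd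
    simp only [LinearMap.mk₂_apply]
    have j := A.jacobi p q x y z hx hy
    have l₁ := A.D_leibniz p x y hx
    have l₂ := A.D_leibniz p x z hx
    have l₃ := A.D_leibniz q y z hy
    have s := A.br_antisymm _ _ _ _ (A.D_odd _ _ hx) hy
    -- Δ is odd, so a homogeneous even element has no Δ-component.
    have hc' : p = 0 → c = 0 := fun h => by subst h; simpa using hc
    have hd' : q = 0 → d = 0 := fun h => by subst h; simpa using hd
    have p₁ := A.parity_of_mem (A.br_mem _ _ _ _ hx hy)
    have p₂ := A.parity_of_mem (A.D_odd _ _ hx)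
    have p₃ := A.parity_of_mem (A.D_odd _ _ hy)
    have p₄ := A.parity_of_mem hx
    have p₅ := A.parity_of_mem hy
    rcases zmod_two_cases p with rfl | rfl <;> rcases zmod_two_cases q with rfl | rfl <;>
      simp [hc', hd', s, j, l₁, l₂, l₃, p₁, p₂, p₃, p₄, p₅, A.D_sq,
        show (1 : ZMod 2) + 1 = 0 from rfl] <;>
      module
  D := 0
  D_odd _ _ _ := zero_mem _
  D_leibniz _ _ _ _ := by
    simp only [LinearMap.zero_apply, map_zero, smul_zero, add_zero]
  D_sq _ := rfl

end Adjoin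

end DiffLieSuperalgebra

end DerivedBrackets

namespace DerivedBrackets

/-! ### Brackets of ΠL ⊕ V as iterated linear steps. -/

section Fold

variable {𝕜 : Type u} [Field 𝕜] {S Z : Type*} [AddCommGroup S] [Module 𝕜 S] [AddCommGroup Z]
  [Module 𝕜 Z] (φ : S →ₗ[𝕜] Z →ₗ[𝕜] S)

/-- The iteration of a bilinear map, as a linear map. -/
def foldHom : List Z → S →ₗ[𝕜] S
  | [] => LinearMap.id
  | z :: l => foldHom l ∘ₗ φ.flip z

@[simp] theorem foldHom_nil (s : S) : foldHom φ [] s = s := rfl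

@[simp] theorem foldHom_cons (z : Z) (l : List Z) (s : S) :
    foldHom φ (z :: l) s = foldHom φ l (φ s z) := rfl

theorem foldHom_append (l r : List Z) (s : S) :
    foldHom φ (l ++ r) s = foldHom φ r (foldHom φ l s) := by
  induction l generalizing s with
  | nil => rfl
  | cons z l ih => exact ih _

theorem foldHom_isMultilinearFamily (s : S) :
    IsMultilinearFamily (𝕜 := 𝕜) fun l => foldHom φ l s where
  map_add l r x y := by simp only [foldHom_append, foldHom_cons, map_add]
  map_smul l r c x := by simp only [foldHom_append, foldHom_cons, map_smul]

end Fold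

namespace DiffLieSuperalgebra

variable {𝕜 : Type u} [Field 𝕜] {L : Type v} [AddCommGroup L] [Module 𝕜 L]
  (A : DiffLieSuperalgebra 𝕜 L)

/-- `[…[Da₁, a₂], …, aₙ]`, and zero for `n = 0`. -/
def nestedDeriv : List L → L
  | [] => 0
  | a :: l => A.nested (A.D a) l

variable {K V : Submodule 𝕜 L}

section State

variable (V)

/-- One step in the computation of a bracket in `ΠL ⊕ V` from the left to the right. The state
consists of a scalar that is nonzero only at the start, of the operators `x ↦ […[x, a₁], …, aₙ]`
without and with the parity operator applied to the arguments, and of the value reached. -/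
noncomputable def cocylStep : (𝕜 × (L →ₗ[𝕜] L) × (L →ₗ[𝕜] L) × L) →ₗ[𝕜] (L × V) →ₗ[𝕜]
    (𝕜 × (L →ₗ[𝕜] L) × (L →ₗ[𝕜] L) × L) :=
  LinearMap.mk₂ 𝕜
    (fun s z => (0, A.br.flip z.2 ∘ₗ s.2.1, A.br.flip (A.parity z.2) ∘ₗ s.2.2.1,
      A.br s.2.2.2 z.2 + s.2.1 (A.oddPart z.1) + s.2.2.1 (A.evenPart z.1) + s.1 • A.D z.2))
    (fun s t z => by
      simp only [Prod.fst_add, Prod.snd_add, LinearMap.comp_add, LinearMap.add_apply, map_add,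
        add_smul, Prod.mk_add_mk, add_zero, Prod.mk.injEq, true_and]
      abel)
    (fun c s z => by
      simp only [Prod.smul_fst, Prod.smul_snd, LinearMap.comp_smul, LinearMap.smul_apply, map_smul,
        smul_assoc, Prod.smul_mk, smul_zero, smul_add])
    (fun s z w => by
      simp only [Prod.fst_add, Prod.snd_add, LinearMap.add_comp, Submodule.coe_add, map_add,
        smul_add, Prod.mk_add_mk, add_zero, Prod.mk.injEq, true_and]
      abel)
    (fun c s z => by
      simp only [Prod.smul_fst, Prod.smul_snd, LinearMap.smul_comp, Submodule.coe_smul, map_smul,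
        Prod.smul_mk, smul_zero, smul_add, smul_comm c s.1])

theorem cocylStep_apply (c : 𝕜) (T U : L →ₗ[𝕜] L) (y x : L) (a : V) :
    A.cocylStep V (c, T, U, y) (x, a) =
      (0, A.br.flip a ∘ₗ T, A.br.flip (A.parity a) ∘ₗ U,
        A.br y a + T (A.oddPart x) + U (A.evenPart x) + c • A.D a) := rfl

/-- Unrolls the recursion from an arbitrary state. From the state (1, id, id, 0) the right-hand side
is the expression that is projected in `cocylBracket`, so its laws reduce to properties of a single
step. -/
theorem foldHom_cocylStep (c : 𝕜) (T U : L →ₗ[𝕜] L) (y : L) (z : List (L × V)) :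
    (foldHom (A.cocylStep V) z (c, T, U, y)).2.2.2 =
      A.nested y (z.map fun w => (w.2 : L)) + c • A.nestedDeriv (z.map fun w => (w.2 : L)) +
      ∑ i : Fin z.length,
        (A.nested (T (A.oddPart (z.get i).1))
          ((z.take i).map (fun w => (w.2 : L)) ++ (z.drop (i + 1)).map fun w => (w.2 : L)) +
        A.nested (U (A.evenPart (z.get i).1))
          (((z.take i).map fun w => (w.2 : L)).map A.parity ++
            (z.drop (i + 1)).map fun w => (w.2 : L))) := by
  induction z generalizing c T U y with
  | nil => simp [nestedDeriv]
  | cons w z ih =>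
    obtain ⟨x, a⟩ := w
    rw [foldHom_cons, cocylStep_apply, ih]
    simp only [List.length_cons, Fin.sum_univ_succ, List.map_cons, nested_cons, nested_add,
      nestedDeriv, zero_smul, add_zero]
    simp [← nestedHom_apply]
    abel

end State

/-! ### Multilinearity, symmetry and parity of the brackets on ΠL ⊕ V. -/

section Bracket

/-- The element of `L` that is projected to the `V`-component of a bracket in `ΠL ⊕ V`. -/
noncomputable def cocylValue (z : List (L × V)) : L :=
  (foldHom (A.cocylStep V) z (1, LinearMap.id, LinearMap.id, 0)).2.2.2

variable (h : IsCompl K V)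

theorem derivedBracket_eq (l : List V) :
    A.derivedBracket h l = V.projectionOnto K h.symm (A.nestedDeriv (l.map (↑))) := by
  match l with
  | [] => exact (map_zero _).symm
  | _ :: _ => rfl

theorem cocylBracket_eq (z : List (L × V)) :
    A.cocylBracket h z =
      (A.shiftBracket (z.map Prod.fst), V.projectionOnto K h.symm (A.cocylValue z)) := by
  rw [cocylBracket, cocylValue, foldHom_cocylStep, derivedBracket_eq]
  simp only [nested_zero, zero_add, one_smul, map_add, map_sum, List.map_map]
  rfl

theorem cocylValue_isMultilinearFamily :
    IsMultilinearFamily (𝕜 := 𝕜) (A.cocylValue (V := V)) :=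
  (foldHom_isMultilinearFamily (A.cocylStep V) _).comp_linearMap
    (LinearMap.snd _ _ _ ∘ₗ LinearMap.snd _ _ _ ∘ₗ LinearMap.snd _ _ _)

theorem cocyl_isMultilinearFamily : IsMultilinearFamily (𝕜 := 𝕜) (A.cocylBracket h) := by
  have hs := A.shift_isMultilinearFamily
  have hv := A.cocylValue_isMultilinearFamily (V := V)
  constructor
  · intro l r x y
    simp only [cocylBracket_eq, hv.map_add, List.map_append, List.map_cons, Prod.fst_add,
      hs.map_add, map_add, Prod.mk_add_mk]
  · intro l r c x
    simp only [cocylBracket_eq, hv.map_smul, List.map_append, List.map_cons, Prod.smul_fst,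
      hs.map_smul, map_smul, Prod.smul_mk]

/-- The grading of `ΠL ⊕ V`. -/
abbrev cocylGr (V : Submodule 𝕜 L) (p : ZMod 2) : Submodule 𝕜 (L × V) :=
  (A.gr (p + 1)).prod ((A.gr p).comap V.subtype)

/-- Graded symmetry for two neighbours is local: once two consecutive steps commute up to the Koszul
sign on every state, what precedes and follows them is irrelevant. -/
theorem cocylStep_cocylStep (hVbr : ∀ a ∈ V, ∀ b ∈ V, A.br a b = 0) {p q : ZMod 2} {z w : L × V}
    (hz : z ∈ A.cocylGr V p) (hw : w ∈ A.cocylGr V q)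
    (s : 𝕜 × (L →ₗ[𝕜] L) × (L →ₗ[𝕜] L) × L) :
    A.cocylStep V (A.cocylStep V s z) w =
      ((-1 : ℤˣ) ^ (p * q)) • A.cocylStep V (A.cocylStep V s w) z := by
  obtain ⟨c, T, U, y⟩ := s
  obtain ⟨x, a, ha⟩ := z
  obtain ⟨x', b, hb⟩ := w
  obtain ⟨hx, ha'⟩ := hz
  obtain ⟨hx', hb'⟩ := hw
  dsimp only [Submodule.mem_comap, Submodule.subtype_apply] at hx hx'
  replace ha' : a ∈ A.gr p := ha'
  replace hb' : b ∈ A.gr q := hb'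
  simp only [cocylStep_apply]
  have hc := A.br_br_comm hVbr ha' hb' ha hb
  have e : ∀ x : L, A.br (A.br x (A.parity a)) (A.parity b) =
      ((-1 : ℤˣ) ^ (p * q)) • A.br (A.br x (A.parity b)) (A.parity a) := by
    intro x
    rw [A.parity_of_mem ha', A.parity_of_mem hb']
    rw [map_intUnits_smul (A.br x), br_intUnits_smul, map_intUnits_smul (A.br (A.br x a)),
      map_intUnits_smul (A.br x), br_intUnits_smul, map_intUnits_smul (A.br (A.br x b)), hc]
    simp only [smul_smul]
    congr 1
    ac_rfl
  -- Apply `D` to [a, b] = 0; this is the symmetry of the binary derived bracket before projection.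
  have hD : A.br (A.D a) b = ((-1 : ℤˣ) ^ (p * q)) • A.br (A.D b) a := by
    have key : ∀ p q : ZMod 2, p + 1 + (p * (q + 1) + 1) = p * q := by decide
    have := A.D_leibniz p a b ha'
    rw [hVbr a ha b hb, map_zero, A.br_swap ha' (A.D_odd _ _ hb'), sign_smul_smul] at this
    rw [eq_neg_of_add_eq_zero_left this.symm, neg_sign_smul, add_right_comm, key]
  have e₁ : (0 : 𝕜) = ((-1 : ℤˣ) ^ (p * q)) • (0 : 𝕜) := (smul_zero _).symm
  have e₂ : A.br.flip b ∘ₗ A.br.flip a ∘ₗ T =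
      ((-1 : ℤˣ) ^ (p * q)) • A.br.flip a ∘ₗ A.br.flip b ∘ₗ T :=
    LinearMap.ext fun x => hc (T x)
  have e₃ : A.br.flip (A.parity b) ∘ₗ A.br.flip (A.parity a) ∘ₗ U =
      ((-1 : ℤˣ) ^ (p * q)) • A.br.flip (A.parity a) ∘ₗ A.br.flip (A.parity b) ∘ₗ U :=
    LinearMap.ext fun x => e (U x)
  refine Prod.ext e₁ (Prod.ext e₂ (Prod.ext e₃ ?_))
  change _ = ((-1 : ℤˣ) ^ (p * q)) • (_ : L)
  simp only [map_add, LinearMap.add_apply, map_smul, LinearMap.smul_apply, hc, hD, zero_smul,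
    add_zero, smul_add, LinearMap.comp_apply, LinearMap.flip_apply]
  rw [A.oddPart_of_mem hx, A.oddPart_of_mem hx', A.evenPart_of_mem hx, A.evenPart_of_mem hx',
    A.parity_of_mem ha', A.parity_of_mem hb']
  rcases zmod_two_cases p with rfl | rfl <;> rcases zmod_two_cases q with rfl | rfl <;>
    simp [show (1 : ZMod 2) + 1 = 0 from rfl] <;> abel

theorem cocyl_isGradedSymmetric (hVbr : ∀ a ∈ V, ∀ b ∈ V, A.br a b = 0) :
    IsGradedSymmetric (A.cocylGr V) (A.cocylBracket h) := by
  intro l r p q z w hz hw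
  rw [cocylBracket_eq, cocylBracket_eq]
  have h₁ := A.shift_isGradedSymmetric (l.map Prod.fst) (r.map Prod.fst) p q z.1 w.1 hz.1 hw.1
  have h₂ : A.cocylValue (l ++ z :: w :: r) =
      ((-1 : ℤˣ) ^ (p * q)) • A.cocylValue (l ++ w :: z :: r) := by
    simp only [cocylValue, foldHom_append, foldHom_cons]
    rw [A.cocylStep_cocylStep hVbr hz hw, map_intUnits_smul]
    rfl
  simp only [List.map_append, List.map_cons]
  rw [h₁, h₂, map_intUnits_smul]
  rfl

theorem IsGradedSubspace.exists_add {A : DiffLieSuperalgebra 𝕜 L} {S : Submodule 𝕜 L}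
    (hS : A.IsGradedSubspace S) {x : L} (hx : x ∈ S) (p : ZMod 2) :
    ∃ y ∈ S ⊓ A.gr p, ∃ z ∈ S ⊓ A.gr (p + 1), x = y + z := by
  obtain ⟨y, hy, z, hz, rfl⟩ := hS x hx
  rcases zmod_two_cases p with rfl | rfl
  · exact ⟨y, hy, z, hz, rfl⟩
  · exact ⟨z, hz, y, hy, add_comm _ _⟩

theorem eq_zero_of_mem_of_mem {p : ZMod 2} {x : L} (h₀ : x ∈ A.gr p) (h₁ : x ∈ A.gr (p + 1)) :
    x = 0 := by
  rcases zmod_two_cases p with rfl | rfl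
  · exact Submodule.disjoint_def.1 A.isCompl.disjoint x h₀ h₁
  · exact Submodule.disjoint_def.1 A.isCompl.disjoint x h₁ h₀

/-- The projection onto `V` is even. -/
theorem projection_mem (hK : A.IsGradedSubspace K) (hV : A.IsGradedSubspace V) {p : ZMod 2} {x : L}
    (hx : x ∈ A.gr p) : (V.projectionOnto K h.symm x : L) ∈ A.gr p := by
  obtain ⟨v, hv, w, hw, e⟩ := hV.exists_add (V.projectionOnto K h.symm x).2 p
  obtain ⟨k, hk, l, hl, e'⟩ := hK.exists_add (K.projectionOnto V h x).2 p
  have hsum : v + w + (k + l) = x := by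
    rw [← e, ← e']
    exact Submodule.projection_add_projection_eq_self h.symm x
  -- `w` and `l` are the components of wrong parity in V and K. Their sum is homogeneous of both
  -- parities, hence zero, and K ∩ V = 0 then kills `w`.
  have h0 : w + l = 0 := by
    refine A.eq_zero_of_mem_of_mem (p := p) ?_ (add_mem hw.2 hl.2)
    rw [show w + l = x - v - k by rw [← hsum]; abel]
    exact sub_mem (sub_mem hx hv.2) hk.2
  have hw0 : w = 0 := Submodule.disjoint_def.1 h.disjoint w
    (eq_neg_of_add_eq_zero_left h0 ▸ neg_mem hl.1) hw.1
  rw [e, hw0, add_zero]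
  exact hv.2

theorem cocylValue_mem {l : List (L × V)} {p : List (ZMod 2)}
    (hl : List.Forall₂ (fun z i => z ∈ A.cocylGr V i) l p) :
    A.cocylValue l ∈ A.gr (1 + p.sum) := by
  -- Here `d` is the total parity of the arguments already read; the scalar `c` is nonzero only
  -- before the first one, when `d = 0`.
  suffices ∀ (c : 𝕜) (T U : L →ₗ[𝕜] L) (y : L) (d : ZMod 2), c = 0 ∨ d = 0 →
      (∀ q, ∀ x ∈ A.gr q, T x ∈ A.gr (q + d)) → (∀ q, ∀ x ∈ A.gr q, U x ∈ A.gr (q + d)) →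
      y ∈ A.gr (1 + d) →
      (foldHom (A.cocylStep V) l (c, T, U, y)).2.2.2 ∈ A.gr (1 + d + p.sum) by
    simpa [cocylValue] using this 1 LinearMap.id LinearMap.id 0 0 (Or.inr rfl)
      (fun q x hx => by simpa using hx) (fun q x hx => by simpa using hx) (zero_mem _)
  induction hl with
  | nil => exact fun c T U y d _ _ _ hy => by simpa using hy
  | @cons z i l p hz hl ih =>
    intro c T U y d hd hT hU hy
    obtain ⟨x, a⟩ := z
    obtain ⟨hx, ha⟩ := hz
    replace hx : x ∈ A.gr (i + 1) := hx
    replace ha : (a : L) ∈ A.gr i := ha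
    rw [List.sum_cons, foldHom_cons, cocylStep_apply, show 1 + d + (i + p.sum) =
      1 + (d + i) + p.sum by ring]
    refine ih _ _ _ _ _ (Or.inl rfl) (fun q x hx => ?_) (fun q x hx => ?_) ?_
    · rw [← add_assoc]
      exact A.br_mem _ _ _ _ (hT q x hx) ha
    · rw [← add_assoc]
      exact A.br_mem _ _ _ _ (hU q x hx) (A.parity_mem ha)
    · have e : i + 1 + d = 1 + (d + i) := by ring
      refine add_mem (add_mem (add_mem ?_ ?_) ?_) ?_
      · rw [← add_assoc]
        exact A.br_mem _ _ _ _ hy ha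
      · rw [A.oddPart_of_mem hx, ← e]
        split_ifs
        · exact hT _ _ hx
        · rw [map_zero]; exact zero_mem _
      · rw [A.evenPart_of_mem hx, ← e]
        split_ifs
        · exact hU _ _ hx
        · rw [map_zero]; exact zero_mem _
      · rcases hd with rfl | rfl
        · rw [zero_smul]; exact zero_mem _
        · rw [zero_add, add_comm 1]
          exact Submodule.smul_mem _ _ (A.D_odd _ _ ha)

theorem cocyl_hasParity (hK : A.IsGradedSubspace K) (hV : A.IsGradedSubspace V) :
    HasParity (A.cocylGr V) (A.cocylGr V) 1 (A.cocylBracket h) := by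
  intro l p hl
  rw [cocylBracket_eq]
  exact ⟨A.shift_hasParity _ _ (List.forall₂_map_left_iff.2 (hl.imp fun _ _ hz => hz.1)),
    A.projection_mem h hK hV (A.cocylValue_mem hl)⟩

end Bracket

end DiffLieSuperalgebra

end DerivedBrackets

namespace DerivedBrackets

namespace DiffLieSuperalgebra

variable {𝕜 : Type u} [Field 𝕜] {L : Type v} [AddCommGroup L] [Module 𝕜 L]
  (A : DiffLieSuperalgebra 𝕜 L) {K V : Submodule 𝕜 L}

/-! ### Brackets with few arguments from ΠL. -/

section Values

theorem evenPart_add_oddPart (x : L) : A.oddPart x + A.evenPart x = x :=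
  Submodule.projection_add_projection_eq_self A.isCompl.symm x

theorem cocylValue_inr (l : List V) :
    A.cocylValue (l.map (LinearMap.inr 𝕜 L V)) = A.nestedDeriv (l.map (↑)) := by
  rw [cocylValue, foldHom_cocylStep]
  simp [Function.comp_def]

theorem cocylValue_cons_inr (z : L × V) (l : List V) :
    A.cocylValue (z :: l.map (LinearMap.inr 𝕜 L V)) =
      A.nested (z.1 + A.D z.2) (l.map (↑)) := by
  rw [cocylValue, foldHom_cons, cocylStep_apply, foldHom_cocylStep]
  simp [Function.comp_def, evenPart_add_oddPart]

/-- Here `z` plays the role of an inner bracket. The zero V-entry of the second argument kills every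
term in which that argument does not supply its ΠL-entry, so only `z.2` matters; the sign is that of
moving Πy to the front. -/
theorem cocylValue_cons_inl_inr {r q : ZMod 2} {z : L × V} {y : L} (hz : (z.2 : L) ∈ A.gr r)
    (hy : y ∈ A.gr (q + 1)) (l : List V) :
    A.cocylValue (z :: (y, 0) :: l.map (LinearMap.inr 𝕜 L V)) =
      ((-1 : ℤˣ) ^ (q * r)) • A.nested (A.br y z.2) (l.map (↑)) := by
  rw [cocylValue, foldHom_cons, cocylStep_apply, foldHom_cons, cocylStep_apply, foldHom_cocylStep,
    A.oddPart_of_mem hy, A.evenPart_of_mem hy, A.parity_of_mem hz, ← nested_intUnits_smul]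
  rcases zmod_two_cases q with rfl | rfl
  · simp [Function.comp_def]
  · simp [Function.comp_def, show (1 : ZMod 2) + 1 = 0 from rfl]

theorem cocylValue_inl_inl (x y : L) (l : List (L × V)) :
    A.cocylValue ((x, 0) :: (y, 0) :: l) = 0 := by
  rw [cocylValue, foldHom_cons, cocylStep_apply, foldHom_cons, cocylStep_apply]
  have : ∀ s : 𝕜 × (L →ₗ[𝕜] L) × (L →ₗ[𝕜] L) × L, s = 0 →
    (foldHom (A.cocylStep V) l s).2.2.2 = 0 := by rintro _ rfl; simp
  refine this _ ?_
  simp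

/-- Every term takes a ΠL-entry from at most one argument, so one of the two zero V-entries always
enters a bracket. -/
theorem cocylValue_cons_inl_inl (z : L × V) (x y : L) (l : List (L × V)) :
    A.cocylValue (z :: (x, 0) :: (y, 0) :: l) = 0 := by
  rw [cocylValue, foldHom_cons, cocylStep_apply, foldHom_cons, cocylStep_apply, foldHom_cons,
    cocylStep_apply]
  have : ∀ s : 𝕜 × (L →ₗ[𝕜] L) × (L →ₗ[𝕜] L) × L, s = 0 →
    (foldHom (A.cocylStep V) l s).2.2.2 = 0 := by rintro _ rfl; simp
  refine this _ ?_
  simp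

end Values

/-! ### The projected identity with Δ in place of one or both elements. -/

section Identities

variable (hVbr : ∀ a ∈ V, ∀ b ∈ V, A.br a b = 0) (T : L →ₗ[𝕜] L) (hTV : ∀ x, T x ∈ V)
  (hTgr : ∀ p, ∀ x ∈ A.gr p, T x ∈ A.gr p)
  (hT : ∀ x y, T (A.br x y) = T (A.br (T x) y) + T (A.br x (T y)))
  (hTD : ∀ x, T (A.D x) = T (A.D (T x)))
  {α : Type*} {par : α → ZMod 2} {val : α → L} (hval : ∀ z, val z ∈ A.gr (par z))
  (hV : ∀ z, val z ∈ V)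

theorem adjoinDerivation_br (x y : L × 𝕜) : A.adjoinDerivation.br x y =
    (A.br x.1 y.1 + x.2 • A.D y.1 - y.2 • A.D (A.parity x.1), 0) := rfl

theorem adjoinDerivation_br_one (y : L) :
    A.adjoinDerivation.br (0, 1) (y, 0) = (A.D y, 0) := by
  simp [adjoinDerivation_br]

theorem adjoinDerivation_br_inl (x y : L) :
    A.adjoinDerivation.br (x, 0) (y, 0) = (A.br x y, 0) := by
  simp [adjoinDerivation_br]

theorem adjoinDerivation_br_one_one : A.adjoinDerivation.br (0, 1) (0, 1) = 0 := by
  simp [adjoinDerivation_br]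

theorem adjoinDerivation_nested (x : L) (l : List α) :
    A.adjoinDerivation.nested (x, 0) (l.map fun z => (val z, (0 : 𝕜))) =
      (A.nested x (l.map val), 0) := by
  induction l generalizing x with
  | nil => rfl
  | cons a l ih => simp [adjoinDerivation_br, ih]

theorem adjoinDerivation_nested_one (l : List α) :
    (A.adjoinDerivation.nested (0, 1) (l.map fun z => (val z, (0 : 𝕜)))).1 =
      A.nestedDeriv (l.map val) := by
  match l with
  | [] => rfl
  | a :: l => simp [adjoinDerivation_br, nestedDeriv, adjoinDerivation_nested]

include hTgr in
theorem map_parity (x : L) : T (A.parity x) = A.parity (T x) := by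
  suffices T ∘ₗ A.parity = A.parity ∘ₗ T from LinearMap.congr_fun this x
  refine A.linearMap_ext fun p x hx => ?_
  rw [LinearMap.comp_apply, LinearMap.comp_apply, A.parity_of_mem hx,
    A.parity_of_mem (hTgr p x hx), map_intUnits_smul]

include hVbr hTV hTgr hT hTD hval hV in
/-- The identity for the brackets, with the derivation adjoined as an inner one. -/
theorem adjoinDerivation_identity {p q : ZMod 2} {x y : L × 𝕜}
    (hx : x ∈ A.adjoinDerivation.gr (p + 1)) (hy : y ∈ A.adjoinDerivation.gr (q + 1))
    (l : List α) :
    let val' : α → L × 𝕜 := fun z => (val z, 0)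
    let T' : L × 𝕜 →ₗ[𝕜] L × 𝕜 := LinearMap.inl 𝕜 L 𝕜 ∘ₗ T ∘ₗ LinearMap.fst 𝕜 L 𝕜
    ((-1 : ℤˣ) ^ (p + 1)) • T' (A.adjoinDerivation.nested (A.adjoinDerivation.br x y)
        (l.map val')) +
      unshuffleSum par (fun s t => ((-1 : ℤˣ) ^ (p * q + q)) •
        T' (A.adjoinDerivation.nested (A.adjoinDerivation.br y
          (T' (A.adjoinDerivation.nested x (s.map val')))) (t.map val'))) l +
      unshuffleSum par (fun s t => ((-1 : ℤˣ) ^ p) •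
        T' (A.adjoinDerivation.nested (A.adjoinDerivation.br x
          (T' (A.adjoinDerivation.nested y (s.map val')))) (t.map val'))) l = 0 := by
  refine A.adjoinDerivation.projected_nested_identity (V := V.prod ⊥) ?_ ?_ _ ?_ ?_ ?_ ?_ hx hy l
  · rintro ⟨a, c⟩ ⟨ha, hc⟩ ⟨b, d⟩ ⟨hb, hd⟩
    replace hc : c = 0 := hc
    replace hd : d = 0 := hd
    simp [adjoinDerivation_br, hVbr a ha b hb, hc, hd]
  · exact fun z => ⟨hval z, zero_mem _⟩
  · exact fun x => ⟨hTV _, zero_mem _⟩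
  · exact fun p x hx => ⟨hTgr _ _ hx.1, zero_mem _⟩
  · rintro ⟨x, c⟩ ⟨y, d⟩
    -- The terms containing Δ need PDx = PDPx, once for [Δ, y] = Dy and once for [x, Δ], which is -D
    -- applied to the parity twist of x.
    have h₁ := hTD (A.parity x)
    rw [A.map_parity T hTgr] at h₁
    have h₂ := hTD y
    refine Prod.ext ?_ (add_zero _).symm
    change T (A.br x y + c • A.D y - d • A.D (A.parity x)) =
      T (A.br (T x) y + (0 : 𝕜) • A.D y - d • A.D (A.parity (T x))) +
        T (A.br x (T y) + c • A.D (T y) - (0 : 𝕜) • A.D (A.parity x))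
    simp only [map_add, map_sub, map_smul, zero_smul, h₁, h₂, hT x y, add_zero, sub_zero]
    abel
  · exact fun z => ⟨hV z, rfl⟩

include hVbr hTV hTgr hT hTD hval hV in
-- The case x = Δ, where [Δ, y] = Dy and the iterated brackets of Δ are those of `nestedDeriv`; this
-- is the Jacobi identity with one argument from ΠL.
theorem projected_nested_identity_D {q : ZMod 2} {y : L} (hy : y ∈ A.gr (q + 1)) (l : List α) :
    T (A.nested (-A.D y) (l.map val)) +
      unshuffleSum par (fun s t => ((-1 : ℤˣ) ^ q) •
        T (A.nested (A.br y (T (A.nestedDeriv (s.map val)))) (t.map val))) l +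
      unshuffleSum par (fun s t =>
        T (A.nested (A.D (T (A.nested y (s.map val)))) (t.map val))) l = 0 := by
  have := A.adjoinDerivation_identity hVbr T hTV hTgr hT hTD hval hV (p := 0) (q := q)
    (x := (0, 1)) (y := (y, 0)) ⟨zero_mem _, by simp⟩ ⟨hy, zero_mem _⟩ l
  simp only [LinearMap.comp_apply, LinearMap.fst_apply, adjoinDerivation_nested,
    adjoinDerivation_nested_one, LinearMap.inl_apply, adjoinDerivation_br_one,
    adjoinDerivation_br_inl] at this
  replace this := congrArg (LinearMap.fst 𝕜 L 𝕜) this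
  simp only [map_add, map_unshuffleSum, map_intUnits_smul, LinearMap.fst_apply, zero_mul, zero_add,
    map_zero, uzpow_one, uzpow_zero, one_smul, Units.neg_smul, Prod.fst_neg] at this
  simpa only [← nestedHom_apply, map_neg] using this

include hVbr hTV hTgr hT hTD hval hV in
-- The case x = y = Δ: the first term vanishes by [Δ, Δ] = 0 and the two sums coincide, so twice the
-- claim holds. This is the Jacobi identity of the higher derived brackets.
theorem projected_nested_identity_D_D [CharZero 𝕜] (l : List α) :
    unshuffleSum par (fun s t =>
      T (A.nested (A.D (T (A.nestedDeriv (s.map val)))) (t.map val))) l = 0 := by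
  have := A.adjoinDerivation_identity hVbr T hTV hTgr hT hTD hval hV (p := 0) (q := 0)
    (x := (0, 1)) (y := (0, 1)) ⟨zero_mem _, by simp⟩ ⟨zero_mem _, by simp⟩ l
  simp only [LinearMap.comp_apply, LinearMap.fst_apply, adjoinDerivation_nested,
    adjoinDerivation_nested_one, LinearMap.inl_apply, adjoinDerivation_br_one,
    adjoinDerivation_br_one_one, nested_zero, map_zero, zero_mul, zero_add, uzpow_zero, one_smul,
    smul_zero, ← two_smul 𝕜] at this
  replace this := congrArg (LinearMap.fst 𝕜 L 𝕜) ((smul_eq_zero.1 this).resolve_left two_ne_zero)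
  rwa [map_unshuffleSum, map_zero] at this

end Identities

end DiffLieSuperalgebra

end DerivedBrackets

namespace DerivedBrackets

/-! ### Jacobi identities of ΠL ⊕ V. -/

section Jacobiator

variable {𝕜 : Type u} [Field 𝕜] {X : Type*} [AddCommGroup X] [Module 𝕜 X]
  {gr : ZMod 2 → Submodule 𝕜 X} {f : List X → X}

theorem jacobiatorList_move (hm : IsMultilinearFamily (𝕜 := 𝕜) f) (hs : IsGradedSymmetric gr f)
    {l m r : List (Σ p, gr p)} {x : Σ p, gr p} (h : jacobiatorList gr f (l ++ x :: (m ++ r)) = 0) :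
    jacobiatorList gr f (l ++ (m ++ x :: r)) = 0 := by
  induction m generalizing l with
  | nil => exact h
  | cons a m ih =>
    have := ih (l := l ++ [a]) (by
      have := jacobiatorList_symm hm hs l (m ++ r) a x
      rw [List.cons_append] at h
      rw [h, smul_zero] at this
      simpa using this)
    simpa using this

end Jacobiator

namespace DiffLieSuperalgebra

variable {𝕜 : Type u} [Field 𝕜] {L : Type v} [AddCommGroup L] [Module 𝕜 L]
  (A : DiffLieSuperalgebra 𝕜 L) {K V : Submodule 𝕜 L}

/-- A homogeneous element of `ΠL`, in `ΠL ⊕ V`. -/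
def shiftInl (V : Submodule 𝕜 L) (x : Σ p, A.gr (p + 1)) : Σ p, A.cocylGr V p :=
  ⟨x.1, (x.2, 0), x.2.2, zero_mem _⟩

/-- A homogeneous element of `V`, in `ΠL ⊕ V`. -/
def shiftInr (a : Σ p, (A.gr p).comap V.subtype) : Σ p, A.cocylGr V p :=
  ⟨a.1, (0, a.2), zero_mem _, a.2.2⟩

variable (h : IsCompl K V)

/-- Split each argument as (x, 0) + (0, a) by additivity, and sort the pure arguments by graded
symmetry, which changes the Jacobiator only by a sign. -/
theorem cocyl_jacobi_of_pure (hVbr : ∀ a ∈ V, ∀ b ∈ V, A.br a b = 0)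
    (H : ∀ (xs : List (Σ p, A.gr (p + 1))) (as : List (Σ p, (A.gr p).comap V.subtype)),
      jacobiatorList (A.cocylGr V) (A.cocylBracket h)
        (xs.map (A.shiftInl V) ++ as.map A.shiftInr) = 0)
    (l : List (Σ p, A.cocylGr V p)) :
    jacobiatorList (A.cocylGr V) (A.cocylBracket h) l = 0 := by
  have hm := A.cocyl_isMultilinearFamily h
  have hs := A.cocyl_isGradedSymmetric h hVbr
  suffices ∀ (xs : List (Σ p, A.gr (p + 1))) (as : List (Σ p, (A.gr p).comap V.subtype)),
      jacobiatorList (A.cocylGr V) (A.cocylBracket h)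
        (xs.map (A.shiftInl V) ++ (as.map A.shiftInr ++ l)) = 0 from this [] []
  induction l with
  | nil => simpa using H
  | cons z l ih =>
    intro xs as
    obtain ⟨p, ⟨x, a⟩, hx, ha⟩ := z
    have e : (⟨p, ⟨(x, a), hx, ha⟩⟩ : Σ p, A.cocylGr V p) =
        ⟨p, ⟨(x, 0), hx, zero_mem _⟩ + ⟨(0, a), zero_mem _, ha⟩⟩ :=
      congrArg (Sigma.mk p) (Subtype.ext (by simp))
    rw [e, ← List.append_assoc, jacobiatorList_add hm]
    have h₁ := ih (xs ++ [⟨p, x, hx⟩]) as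
    have h₂ := ih xs (as ++ [⟨p, a, ha⟩])
    simp only [List.map_append, List.map_cons, List.map_nil, List.append_assoc,
      List.singleton_append] at h₁ h₂ ⊢
    -- The induction hypothesis has the new ΠL-argument in front of the V-arguments; in the goal it
    -- stands behind them.
    have h₃ := jacobiatorList_move hm hs h₁
    refine (congrArg₂ (· + ·) h₃ h₂).trans (add_zero _)

/-- The projection to ΠL respects all brackets, so it sends the Jacobiator to a Jacobiator of ΠL. -/
theorem cocyl_jacobi_fst (l : List (Σ p, A.cocylGr V p)) :
    (jacobiatorList (A.cocylGr V) (A.cocylBracket h) l).1 = 0 := by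
  have := A.shift_jacobi (l.map fun z => ⟨z.1, z.2.1.1, z.2.2.1⟩)
  rw [jacobiatorList, unshuffleSum_map] at this
  rw [← LinearMap.fst_apply (R := 𝕜), jacobiatorList, map_unshuffleSum, ← this]
  simp only [LinearMap.fst_apply, cocylBracket_eq, List.map_cons, values, List.map_map]
  rfl

theorem shiftBracket_map_zero {α : Type*} (l : List α) : A.shiftBracket (l.map fun _ => 0) = 0 := by
  match l with
  | [] => rfl
  | a :: l => exact A.shift_isMultilinearFamily.map_zero (by simp)

theorem cocylBracket_inr (l : List V) :
    A.cocylBracket h (l.map (LinearMap.inr 𝕜 L V)) = (0, A.derivedBracket h l) := by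
  rw [cocylBracket_eq, cocylValue_inr, derivedBracket_eq, List.map_map]
  exact Prod.ext (A.shiftBracket_map_zero l) rfl

theorem cocylBracket_cons_inr (x : L) (l : List V) :
    (A.cocylBracket h ((x, 0) :: l.map (LinearMap.inr 𝕜 L V))).2 =
      V.projectionOnto K h.symm (A.nested x (l.map (↑))) := by
  rw [cocylBracket_eq, cocylValue_cons_inr]
  simp

theorem cocylBracket_inl_inl (x y : L) (l : List (L × V)) :
    A.cocylBracket h ((x, 0) :: (y, 0) :: l) = (A.shiftBracket (x :: y :: l.map Prod.fst), 0) := by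
  rw [cocylBracket_eq, cocylValue_inl_inl, map_zero]
  rfl

section Jacobi

variable (hVbr : ∀ a ∈ V, ∀ b ∈ V, A.br a b = 0)
  (hKbr : ∀ x ∈ K, ∀ y ∈ K, A.br x y ∈ K) (hKD : ∀ x ∈ K, A.D x ∈ K)

include hKD in
-- The K-component of x contributes nothing, because `D` maps K into K = ker P.
theorem projection_D (x : L) :
    V.projection K h.symm (A.D x) = V.projection K h.symm (A.D (V.projection K h.symm x)) := by
  conv_lhs => rw [← Submodule.projection_add_projection_eq_self h.symm x]
  rw [map_add, map_add, (Submodule.projection_apply_eq_zero_iff h.symm).2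
    (hKD _ (Submodule.projection_apply_mem h x)), add_zero]

include hVbr hKbr in
-- Decompose along K ⊕ V: [V, V] = 0 and P[K, K] = 0, so on both sides only the two mixed terms
-- remain.
theorem projection_br (x y : L) :
    V.projection K h.symm (A.br x y) = V.projection K h.symm (A.br (V.projection K h.symm x) y) +
      V.projection K h.symm (A.br x (V.projection K h.symm y)) := by
  obtain ⟨v, hv⟩ : ∃ v, v = V.projection K h.symm x := ⟨_, rfl⟩
  obtain ⟨w, hw⟩ : ∃ v, v = V.projection K h.symm y := ⟨_, rfl⟩
  obtain ⟨k, hk⟩ : ∃ v, v = K.projection V h x := ⟨_, rfl⟩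
  obtain ⟨m, hm⟩ : ∃ v, v = K.projection V h y := ⟨_, rfl⟩
  have hx : v + k = x := hv ▸ hk ▸ Submodule.projection_add_projection_eq_self h.symm x
  have hy : w + m = y := hw ▸ hm ▸ Submodule.projection_add_projection_eq_self h.symm y
  have h₁ : A.br v w = 0 := hVbr _ (hv ▸ Submodule.projection_apply_mem _ _) _
    (hw ▸ Submodule.projection_apply_mem _ _)
  have h₂ : V.projection K h.symm (A.br k m) = 0 :=
    (Submodule.projection_apply_eq_zero_iff h.symm).2 (hKbr _
      (hk ▸ Submodule.projection_apply_mem _ _) _ (hm ▸ Submodule.projection_apply_mem _ _))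
  rw [← hv, ← hw, ← hx, ← hy]
  simp only [map_add, LinearMap.add_apply, h₁, h₂, map_zero]
  abel

variable (hK : A.IsGradedSubspace K) (hV : A.IsGradedSubspace V)

include hVbr hKbr hKD hK hV in
theorem cocyl_jacobi_snd [CharZero 𝕜] (xs : List (Σ p, A.gr (p + 1)))
    (as : List (Σ p, (A.gr p).comap V.subtype)) :
    (jacobiatorList (A.cocylGr V) (A.cocylBracket h)
        (xs.map (A.shiftInl V) ++ as.map A.shiftInr)).2 = 0 := by
  have hT := A.projection_br h hVbr hKbr
  have hTD := A.projection_D h hKD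
  have hTV := Submodule.projection_apply_mem (p := V) (q := K) h.symm
  have hTgr : ∀ p, ∀ x ∈ A.gr p, V.projection K h.symm x ∈ A.gr p :=
    fun p x hx => A.projection_mem h hK hV hx
  have hval : ∀ a : Σ p, (A.gr p).comap V.subtype, (a.2 : L) ∈ A.gr a.1 := fun a => a.2.2
  have hvV : ∀ a : Σ p, (A.gr p).comap V.subtype, (a.2 : L) ∈ V := fun a => a.2.1.2
  rw [← Submodule.coe_eq_zero, ← Submodule.subtype_apply, ← LinearMap.snd_apply (R := 𝕜) (M := L),
    ← LinearMap.comp_apply, jacobiatorList, map_unshuffleSum]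
  have e : ∀ z l, (V.subtype ∘ₗ LinearMap.snd 𝕜 L V) (A.cocylBracket h (z :: l)) =
      V.projection K h.symm (A.cocylValue (z :: l)) := by
    intro z l
    rw [cocylBracket_eq]
    rfl
  have ev : ∀ s : List (Σ p, (A.gr p).comap V.subtype), values (A.cocylGr V) (s.map A.shiftInr) =
      (s.map fun a => (a.2 : V)).map (LinearMap.inr 𝕜 L V) := fun s => by
    simp [shiftInr]
  have ew : ∀ s : List (Σ p, (A.gr p).comap V.subtype),
      (s.map fun a => (a.2 : V)).map ((↑) : V → L) = s.map fun a => (a.2 : L) := fun s => by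
    rw [List.map_map]
    rfl
  have eB : ∀ {r q : ZMod 2} {z : L × V} {y : L} (_ : (z.2 : L) ∈ A.gr r) (_ : y ∈ A.gr (q + 1))
      (t : List (Σ p, (A.gr p).comap V.subtype)),
      V.projection K h.symm (A.cocylValue
          (z :: (y, 0) :: (t.map fun a => (a.2 : V)).map (LinearMap.inr 𝕜 L V))) =
        ((-1 : ℤˣ) ^ (q * r)) •
          V.projection K h.symm (A.nested (A.br y z.2) (t.map fun a => (a.2 : L))) := by
    intro r q z y hz hy t
    rw [A.cocylValue_cons_inl_inr hz hy, map_intUnits_smul, ew]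
  have eD : ∀ s : List (Σ p, (A.gr p).comap V.subtype),
      A.nestedDeriv (s.map fun a => (a.2 : L)) ∈ A.gr (1 + totalParity Sigma.fst s) := by
    intro s
    match s with
    | [] => exact zero_mem _
    | a :: s =>
      have := A.nested_mem hval (A.D_odd _ _ (hval a)) s
      rwa [add_comm a.1, add_assoc] at this
  have eσ : (Sigma.fst ∘ A.shiftInr : (Σ p, (A.gr p).comap V.subtype) → ZMod 2) = Sigma.fst := rfl
  have ep : ∀ s : List (Σ p, (A.gr p).comap V.subtype),
      totalParity Sigma.fst (s.map A.shiftInr) = totalParity Sigma.fst s := fun s => by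
    rw [totalParity, List.map_map, eσ, totalParity]
  have eA : ∀ (x : L) (s : List (Σ p, (A.gr p).comap V.subtype)),
      (A.cocylBracket h ((x, 0) :: (s.map fun a => (a.2 : V)).map (LinearMap.inr 𝕜 L V))).1 =
        if s = [] then -A.D x else 0 := by
    intro x s
    rw [cocylBracket_eq]
    match s with
    | [] => rfl
    | a :: s => exact A.shift_isMultilinearFamily.map_zero (by simp)
  simp only [e]
  match xs with
  | [] =>
    rw [List.map_nil, List.nil_append, unshuffleSum_map]
    have := A.projected_nested_identity_D_D hVbr _ hTV hTgr hT hTD hval hvV as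
    simpa only [ev, cocylBracket_inr, cocylValue_cons_inr, zero_add, derivedBracket_eq, ew,
      Submodule.coe_projectionOnto_apply, eσ] using this
  | [⟨q, y, hy⟩] =>
    have := A.projected_nested_identity_D hVbr _ hTV hTgr hT hTD hval hvV hy as
    simp only [List.map_cons, List.map_nil, List.singleton_append, unshuffleSum, unshuffleSum_map,
      ev, shiftInl, cocylValue_cons_inr, cocylBracket_cons_inr, cocylBracket_inr, nested_add,
      map_add, ew, Submodule.coe_projectionOnto_apply, derivedBracket_eq, eσ, ep, eA]
    refine Eq.trans ?_ this
    rw [unshuffleSum_add, add_right_comm]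
    congr 2
    · rw [unshuffleSum_nil_left _ fun a s t => by simp]
      simp
    · congr 1
      funext s t
      -- Πy first passes the block `s`, of parity s, and then the inner bracket of that block, of
      -- parity 1 + s.
      have key : ∀ q s : ZMod 2, q * s + q * (1 + s) = q := by decide
      rw [eB (hTgr _ _ (eD s)) hy, sign_smul_smul, key]
      rfl
  | [⟨p, x, hx⟩, ⟨q, y, hy⟩] =>
    have := A.projected_nested_identity hVbr hval _ hTV hTgr hT hvV hx hy as
    have key : ∀ p q s : ZMod 2, q * s + q * (p + 1 + s) = p * q + q ∧
        p * (q + s) + p * (q + 1 + s) = p := by decide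
    have hP : ∀ {p : ZMod 2} {x : L} (_ : x ∈ A.gr (p + 1))
        (s : List (Σ p, (A.gr p).comap V.subtype)),
        ((A.cocylBracket h ((x, 0) :: (s.map fun a => (a.2 : V)).map
          (LinearMap.inr 𝕜 L V))).2 : L) ∈ A.gr (p + 1 + totalParity Sigma.fst s) := by
      intro p x hx s
      rw [cocylBracket_cons_inr, ew]
      exact hTgr _ _ (A.nested_mem hval hx s)
    simp only [List.map_cons, List.map_nil, List.nil_append, List.cons_append, unshuffleSum,
      unshuffleSum_map, ev, shiftInl, eσ, ep, totalParity_cons, cocylValue_cons_inl_inl, map_zero,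
      smul_zero, unshuffleSum_zero, add_zero, cocylBracket_inl_inl, cocylValue_cons_inr,
      Submodule.coe_zero, ew]
    refine Eq.trans ?_ this
    congr 1
    · congr 1
      -- If Πx and Πy share the inner bracket, it has no V-component, and its ΠL-component is zero
      -- as soon as a third argument is present.
      · rw [unshuffleSum_nil_left _ fun a s t => by simp]
        simp [A.br_parity hx, nested_intUnits_smul]
      · congr 1
        funext s t
        rw [eB (hP hx s) hy, sign_smul_smul, (key _ _ _).1, cocylBracket_cons_inr, ew,
          Submodule.coe_projectionOnto_apply]
    · congr 1
      funext s t
      rw [eB (hP hy s) hx, sign_smul_smul, (key _ _ _).2, cocylBracket_cons_inr, ew,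
        Submodule.coe_projectionOnto_apply]
  -- Two ΠL-arguments in the inner bracket kill its V-component and three kill it altogether; two in
  -- the outer bracket besides the inner value kill the outer V-component.
  | x :: y :: z :: xs =>
    have h0 : ∀ l : List (L × V), A.cocylValue ((0, 0) :: l) = 0 :=
      fun l => A.cocylValue_isMultilinearFamily.map_zero (List.mem_cons_self ..)
    simp only [List.map_cons, List.cons_append, unshuffleSum, shiftInl, cocylBracket_inl_inl,
      cocylValue_inl_inl, cocylValue_cons_inl_inl, shiftBracket_cons₃, h0, map_zero, smul_zero,
      unshuffleSum_zero, add_zero]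

end Jacobi

end DiffLieSuperalgebra

end DerivedBrackets

namespace DerivedBrackets

/-! ### The cocylinder and its fiber. -/

namespace DiffLieSuperalgebra

variable {𝕜 : Type u} [Field 𝕜] {L : Type v} [AddCommGroup L] [Module 𝕜 L]
  (A : DiffLieSuperalgebra 𝕜 L) {K V : Submodule 𝕜 L} (h : IsCompl K V)

theorem IsGradedSubspace.isCompl_comap {A : DiffLieSuperalgebra 𝕜 L} {S : Submodule 𝕜 L}
    (hS : A.IsGradedSubspace S) :
    IsCompl ((A.gr 0).comap S.subtype) ((A.gr 1).comap S.subtype) := by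
  constructor
  · rw [Submodule.disjoint_def]
    intro x h0 h1
    exact Subtype.ext (Submodule.disjoint_def.1 A.isCompl.disjoint x.1 h0 h1)
  · rw [codisjoint_iff, eq_top_iff]
    rintro ⟨x, hx⟩ -
    obtain ⟨y, hy, z, hz, h⟩ := hS x hx
    exact Submodule.mem_sup.2 ⟨⟨y, hy.1⟩, hy.2, ⟨z, hz.1⟩, hz.2, Subtype.ext h.symm⟩

theorem cocyl_isLInfinityAlgebra [CharZero 𝕜] (hVbr : ∀ a ∈ V, ∀ b ∈ V, A.br a b = 0)
    (hKbr : ∀ x ∈ K, ∀ y ∈ K, A.br x y ∈ K) (hKD : ∀ x ∈ K, A.D x ∈ K)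
    (hK : A.IsGradedSubspace K) (hV : A.IsGradedSubspace V) :
    (A.cocylSpace h).IsLInfinityAlgebra :=
  BracketSpace.isLInfinityAlgebra_of_list (A := A.cocylSpace h)
    (prod_isCompl A.isCompl.symm hV.isCompl_comap) (A.cocyl_isMultilinearFamily h)
    (A.cocyl_isGradedSymmetric h hVbr) (A.cocyl_hasParity h hK hV)
    (A.cocyl_jacobi_of_pure h hVbr fun xs as =>
      Prod.ext (A.cocyl_jacobi_fst h _) (A.cocyl_jacobi_snd h hVbr hKbr hKD hK hV xs as))

theorem derived_isLInfinityAlgebra (hV : A.IsGradedSubspace V)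
    (hZ : (A.cocylSpace h).IsLInfinityAlgebra) : (A.derivedSpace h).IsLInfinityAlgebra :=
  BracketSpace.IsLInfinityAlgebra.of_injective (A := A.derivedSpace h) (B := A.cocylSpace h) hZ
    (LinearMap.inr 𝕜 L V) (fun _ _ e => congrArg Prod.snd e)
    (fun _ _ => ⟨fun hx => ⟨zero_mem _, hx⟩, fun hx => hx.2⟩)
    (fun l => (A.cocylBracket_inr h l).symm) hV.isCompl_comap

theorem isFiber_derived (hV : A.IsGradedSubspace V) (hZ : (A.cocylSpace h).IsLInfinityAlgebra) :
    IsFiber (A.derivedSpace h) (A.cocylSpace h) A.shift (strict (LinearMap.inr 𝕜 L V))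
      (strict (LinearMap.fst 𝕜 L V)) :=
  BracketSpace.isFiber_strict (F := A.derivedSpace h) (Z := A.cocylSpace h) (Y := A.shift)
    (A.derived_isLInfinityAlgebra h hV hZ) hZ.multilinear (LinearMap.inr 𝕜 L V)
    (LinearMap.fst 𝕜 L V) (LinearMap.snd 𝕜 L V) (fun _ => rfl) (fun _ _ hx => ⟨zero_mem _, hx⟩)
    (fun _ _ hx => hx.2) (fun l => (A.cocylBracket_inr h l).symm) (LinearMap.fst_comp_inr 𝕜 L V)
    (fun _ hz => Prod.ext hz.symm rfl)

section Restrict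

variable (hK : A.IsGradedSubspace K) (hKbr : ∀ x ∈ K, ∀ y ∈ K, A.br x y ∈ K)
  (hKD : ∀ x ∈ K, A.D x ∈ K)

theorem restrict_parity (x : K) : ((A.restrict K hK hKbr hKD).parity x : L) = A.parity x := by
  suffices K.subtype ∘ₗ (A.restrict K hK hKbr hKD).parity = A.parity ∘ₗ K.subtype from
    LinearMap.congr_fun this x
  refine (A.restrict K hK hKbr hKD).linearMap_ext fun p x hx => ?_
  rw [LinearMap.comp_apply, LinearMap.comp_apply, parity_of_mem _ hx, map_intUnits_smul]
  exact (A.parity_of_mem hx).symm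

theorem restrict_shiftBracket (l : List K) :
    ((A.restrict K hK hKbr hKD).shiftBracket l : L) = A.shiftBracket (l.map (↑)) := by
  match l with
  | [] => rfl
  | [x] => rfl
  | [x, y] =>
    rw [List.map_cons, List.map_cons, List.map_nil, shiftBracket_pair, shiftBracket_pair,
      ← A.restrict_parity hK hKbr hKD]
    rfl
  | _ :: _ :: _ :: _ => rfl

/-- The only possible V-component on ΠK is the term Px of the differential, which vanishes for x ∈
K; this is why `j` is defined on ΠK and strict. -/
theorem cocylBracket_inl (l : List K) :
    A.cocylBracket h (l.map ((LinearMap.inl 𝕜 L V).comp K.subtype)) =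
      (((A.restrict K hK hKbr hKD).shiftBracket l : L), 0) := by
  rw [restrict_shiftBracket, cocylBracket_eq, List.map_map]
  refine Prod.ext rfl ?_
  match l with
  | [] => simp [cocylValue]
  | [x] =>
    have := A.cocylValue_cons_inr ((x, 0) : L × V) []
    simp only [List.map_nil] at this
    simp [this]
  | x :: y :: l =>
    simp [cocylValue_inl_inl]

theorem isCocylinder [CharZero 𝕜] (hZ : (A.cocylSpace h).IsLInfinityAlgebra) :
    IsCocylinder (A.restrict K hK hKbr hKD).shift (A.cocylSpace h) A.shift
      (strict K.subtype) (strict ((LinearMap.inl 𝕜 L V).comp K.subtype))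
      (strict (LinearMap.fst 𝕜 L V)) where
  source := shift_isLInfinityAlgebra _
  cocyl := hZ
  target := A.shift_isLInfinityAlgebra
  morphism_f := BracketSpace.isLInfinityMorphism_strict (A := (A.restrict K hK hKbr hKD).shift)
    (B := A.shift) A.shift_isMultilinearFamily K.subtype (fun _ _ hx => hx)
    (A.restrict_shiftBracket hK hKbr hKD)
  morphism_j := BracketSpace.isLInfinityMorphism_strict (A := (A.restrict K hK hKbr hKD).shift)
    (B := A.cocylSpace h) hZ.multilinear ((LinearMap.inl 𝕜 L V).comp K.subtype)
    (fun _ _ hx => ⟨hx, zero_mem _⟩) (fun l => (A.cocylBracket_inl h hK hKbr hKD l).symm)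
  morphism_p := BracketSpace.isLInfinityMorphism_strict (A := A.cocylSpace h)
    (B := A.shift) A.shift_isMultilinearFamily (LinearMap.fst 𝕜 L V) (fun _ _ hx => hx.1)
    (fun l => rfl)
  comp := BracketSpace.isComposite_strict (A := (A.restrict K hK hKbr hKD).shift)
    (B := A.cocylSpace h) (C := A.shift) (LinearMap.fst 𝕜 L V)
    ((LinearMap.inl 𝕜 L V).comp K.subtype)
  cofibration := LinearMap.inl_injective.comp Subtype.val_injective
  weakEquivalence := by
    have hB : ∀ z : L × V, A.cocylBracket h [z] =
        (-A.D z.1, V.projectionOnto K h.symm (z.1 + A.D z.2)) := by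
      intro z
      rw [cocylBracket_eq]
      exact Prod.ext rfl
        (congrArg (V.projectionOnto K h.symm) (A.cocylValue_cons_inr z []))
    refine ⟨rfl, ?_, ?_, ?_⟩
    · exact A.cocylBracket_inr h []
    · rintro ⟨x, hx⟩ - ⟨⟨y, a⟩, hz⟩
      replace hz : (x, (0 : V)) = A.cocylBracket h [(y, a)] := hz
      rw [hB] at hz
      obtain ⟨hz₁, hz₂⟩ := Prod.mk.inj hz
      -- If (Πx, 0) = d(Πy, a), then P(y + Da) = 0 puts y + Da in K, and D² = 0 gives D(y + Da) =
      -- Dy, so Π(y + Da) is a primitive in ΠK.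
      refine ⟨(⟨y + A.D a, (Submodule.projectionOnto_apply_eq_zero_iff h.symm).1 hz₂.symm⟩ : K),
        Subtype.ext ?_⟩
      change x = -A.D (y + A.D a)
      rw [map_add, A.D_sq, add_zero, hz₁]
    · rintro ⟨y, a⟩ hz
      replace hz : A.cocylBracket h [(y, a)] = 0 := hz
      rw [hB] at hz
      obtain ⟨hz₁, hz₂⟩ := Prod.mk.inj hz
      -- Since d(Πa, 0) = (-ΠDa, a), subtracting it removes the V-component of the cycle and leaves
      -- (Π(y + Da), 0).
      refine ⟨(⟨y + A.D a, (Submodule.projectionOnto_apply_eq_zero_iff h.symm).1 hz₂⟩ : K),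
        Subtype.ext ?_, ((a : L), (0 : V)), ?_⟩
      · change -A.D (y + A.D a) = 0
        rw [map_add, A.D_sq, add_zero]
        exact hz₁
      · change (y, a) = (y + A.D a, (0 : V)) + A.cocylBracket h [((a : L), (0 : V))]
        rw [hB]
        simp
  fibration := Prod.fst_surjective

end Restrict

end DiffLieSuperalgebra

end DerivedBrackets

theorem mainTheorem5 {𝕜 : Type u} [Field 𝕜] [CharZero 𝕜] {L : Type v} [AddCommGroup L]
    [Module 𝕜 L] (A : DerivedBrackets.DiffLieSuperalgebra 𝕜 L) (K V : Submodule 𝕜 L)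
    (hKV : IsCompl K V) (hK : A.IsGradedSubspace K) (hV : A.IsGradedSubspace V)
    (hKbr : ∀ x ∈ K, ∀ y ∈ K, A.br x y ∈ K) (hKD : ∀ x ∈ K, A.D x ∈ K)
    (hVbr : ∀ a ∈ V, ∀ b ∈ V, A.br a b = 0) :
    -- `ΠL ⊕ V` is a cocylinder for the inclusion `ΠK → ΠL`, via `Πx ↦ (Πx, 0)`, `(Πx, a) ↦ Πx`
    DerivedBrackets.IsCocylinder (A.restrict K hK hKbr hKD).shift (A.cocylSpace hKV) A.shift
        (DerivedBrackets.strict K.subtype)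
        (DerivedBrackets.strict ((LinearMap.inl 𝕜 L V).comp K.subtype))
        (DerivedBrackets.strict (LinearMap.fst 𝕜 L V)) ∧
      -- `V` with the derived brackets is the fiber of the projection, via `a ↦ (0, a)`
      DerivedBrackets.IsFiber (A.derivedSpace hKV) (A.cocylSpace hKV) A.shift
        (DerivedBrackets.strict (LinearMap.inr 𝕜 L V))
        (DerivedBrackets.strict (LinearMap.fst 𝕜 L V)) ∧
      -- hence it is a homotopy fiber of the inclusion
      DerivedBrackets.IsHomotopyFiber (A.derivedSpace hKV) (A.restrict K hK hKbr hKD).shift A.shift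
        (DerivedBrackets.strict K.subtype) := by
  have hZ := A.cocyl_isLInfinityAlgebra hKV hVbr hKbr hKD hK hV
  have hC := A.isCocylinder hKV hK hKbr hKD hZ
  have hF := A.isFiber_derived hKV hV hZ
  exact ⟨hC, hF, _, _, _, _, hC, hF⟩
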